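/- Let $d\ge 2$ be an integer. Let $E(\mathbb Z^d)$ be the set of ordered nearest-neighbor pairs of $\mathbb Z^d$, and let $\Omega$ be the set of all $\omega=(c_\omega(e))_{e\in E(\mathbb Z^d)}\in(0,\infty)^{E(\mathbb Z^d)}$ with $c_\omega(x,y)=c_\omega(y,x)$ for all $(x,y)\in E(\mathbb Z^d)$. For $\omega\in\Omega$, let $P^0_\omega$ be the law of the discrete-time Markov chain $X=(X_k)_{k\ge0}$ on $\mathbb Z^d$ with $X_0=0$ and transition probabilities $$\mathsf P_\omega(x,y)=\frac{c_\omega(x,y)}{\pi_\omega(x)}\ \text{ for }(x,y)\in E(\mathbb Z^d)\ \ (\text{and }0\text{ otherwise}),\qquad \pi_\omega(x)=\sum_{z\colon(x,z)\in E(\mathbb Z^d)}c_\omega(x,z).$$ For $n\ge1$ and $t\ge0$ set $$B^{(n)}_t=\frac1{\sqrt n}\Bigl(X_{\lfloor tn\rfloor}+(tn-\lfloor tn\rfloor)\bigl(X_{\lfloor tn\rfloor+1}-X_{\lfloor tn\rfloor}\bigr)\Bigr),$$ and let $P^{(n,\omega)}$ be the law of $B^{(n)}$ induced by $P^0_\omega$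 on the space $C([0,\infty),\mathbb R^d)$ of continuous functions, endowed with the topology of locally uniform convergence and its Borel $\sigma$-algebra. Write $\Lambda_n=[-n,n]^d\cap\mathbb Z^d$, let $E(\Lambda_n)$ be the set of edges in $E(\mathbb Z^d)$ with at least one endpoint in $\Lambda_n$, and for real $p,q$ let $$\Omega_{p,q}=\Bigl\{\omega\in\Omega\colon \sup_{n\ge1}\frac1{n^d}\sum_{e\in E(\Lambda_n)}c_\omega(e)^p<\infty\ \text{ and }\ \sup_{n\ge1}\frac1{n^d}\sum_{e\in E(\Lambda_n)}c_\omega(e)^{-q}<\infty\Bigr\}.$$ Suppose that the real numbers $p,q>d/2$ satisfy $$\frac1p+\frac1q<\frac2d.$$ Then for every $\omega\in\Omega_{p,q}$ the family $\{P^{(n,\omega)}\colon n\ge1\}$ of probability measures on $C([0,\infty),\mathbb R^d)$ is tight. -/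

import Mathlib

open MeasureTheory ProbabilityTheory
open scoped NNReal ENNReal

noncomputable section

/-- The vertex set `ℤ^d`. -/
abbrev Site (d : ℕ) : Type := Fin d → ℤ

namespace Site

/-- Nearest-neighbour relation on `ℤ^d`: the `ℓ¹`-distance is one. -/
def Adj {d : ℕ} (x y : Site d) : Prop := ∑ i, |x i - y i| = 1

theorem Adj.symm {d : ℕ} {x y : Site d} (h : Adj x y) : Adj y x := by
  unfold Adj at *
  rw [← h]
  exact Finset.sum_congr rfl fun i _ => abs_sub_comm _ _

theorem Adj.abs_le {d : ℕ} {x y : Site d} (h : Adj x y) (i : Fin d) : |x i - y i| ≤ 1 := by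
  have h' : ∑ i, |x i - y i| = 1 := h
  rw [← h']
  exact Finset.single_le_sum (f := fun i => |x i - y i|) (fun j _ => abs_nonneg _)
    (Finset.mem_univ i)

open Classical in
/-- The finite set of nearest neighbours of `x`. -/
def neighbors {d : ℕ} (x : Site d) : Finset (Site d) :=
  (Fintype.piFinset fun i => Finset.Icc (x i - 1) (x i + 1)).filter fun y => Adj x y

theorem mem_neighbors {d : ℕ} {x y : Site d} : y ∈ neighbors x ↔ Adj x y := by
  classical
  simp only [neighbors, Finset.mem_filter, Fintype.mem_piFinset, Finset.mem_Icc,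
    and_iff_right_iff_imp]
  intro h i
  have := abs_le.1 (h.abs_le i)
  constructor <;> linarith [this.1, this.2]

theorem neighbors_nonempty {d : ℕ} [NeZero d] (x : Site d) : (neighbors x).Nonempty := by
  classical
  refine ⟨x + Pi.single 0 1, mem_neighbors.2 ?_⟩
  unfold Adj
  rw [Finset.sum_eq_single (0 : Fin d)]
  · simp
  · intro b _ hb
    simp [hb]
  · simp

/-- The box `Λ_n = [-n, n]^d ∩ ℤ^d`. -/
def box (d n : ℕ) : Finset (Site d) := Fintype.piFinset fun _ => Finset.Icc (-(n : ℤ)) n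

end Site

/-- The set `E(ℤ^d)` of ordered nearest-neighbour pairs. -/
abbrev LatticeEdge (d : ℕ) : Type := {e : Site d × Site d // Site.Adj e.1 e.2}

namespace LatticeEdge

/-- Reversal of the orientation of an edge. -/
def reverse {d : ℕ} (e : LatticeEdge d) : LatticeEdge d := ⟨(e.1.2, e.1.1), e.2.symm⟩

/-- The set `E(Λ)` of edges incident with at least one vertex in `Λ`. -/
def incident {d : ℕ} (Λ : Finset (Site d)) : Set (LatticeEdge d) :=
  {e | e.1.1 ∈ Λ ∨ e.1.2 ∈ Λ}

theorem finite_incident {d : ℕ} (Λ : Finset (Site d)) : (incident Λ).Finite := by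
  classical
  set N : Finset (Site d) := Λ ∪ Λ.biUnion Site.neighbors with hN
  refine Set.Finite.of_finite_image (f := Subtype.val)
    ((N ×ˢ N).finite_toSet.subset ?_) Subtype.val_injective.injOn
  rintro _ ⟨e, he, rfl⟩
  have h : e.1.1 ∈ N ∧ e.1.2 ∈ N := by
    simp only [hN, Finset.mem_union, Finset.mem_biUnion, Site.mem_neighbors]
    rcases he with he | he
    · exact ⟨Or.inl he, Or.inr ⟨_, he, e.2⟩⟩
    · exact ⟨Or.inr ⟨_, he, e.2.symm⟩, Or.inl he⟩
  simpa using h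

/-- `E(Λ)` as a finset. -/
def incidentFinset {d : ℕ} (Λ : Finset (Site d)) : Finset (LatticeEdge d) :=
  (finite_incident Λ).toFinset

end LatticeEdge

/-- The set `Ω` of admissible conductance configurations: positive functions on the oriented
edges of `ℤ^d` that are invariant under edge reversal. -/
structure Conductances (d : ℕ) where
  c : LatticeEdge d → ℝ
  pos : ∀ e, 0 < c e
  symm : ∀ e, c e.reverse = c e

namespace Conductances

variable {d : ℕ}

open Classical in
/-- The conductance `c_ω(x, y)` of the pair `(x, y)`, set to zero if `x, y` are not neighbours. -/
def weight (ω : Conductances d) (x y : Site d) : ℝ :=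
  if h : Site.Adj x y then ω.c ⟨(x, y), h⟩ else 0

theorem weight_nonneg (ω : Conductances d) (x y : Site d) : 0 ≤ ω.weight x y := by
  unfold weight
  split_ifs
  · exact (ω.pos _).le
  · exact le_rfl

theorem weight_pos (ω : Conductances d) {x y : Site d} (h : Site.Adj x y) :
    0 < ω.weight x y := by
  simp only [weight, h, dif_pos]
  exact ω.pos _

/-- `π_ω(x)`, the sum of the conductances of the edges `(x, z)`. -/
def vertexWeight (ω : Conductances d) (x : Site d) : ℝ := ∑ z ∈ x.neighbors, ω.weight x z

theorem vertexWeight_pos [NeZero d] (ω : Conductances d) (x : Site d) :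
    0 < ω.vertexWeight x :=
  Finset.sum_pos (fun _ hz => ω.weight_pos (Site.mem_neighbors.1 hz)) x.neighbors_nonempty

/-- The transition probability `P_ω(x, y) = c_ω(x, y) / π_ω(x)`. -/
def transProb (ω : Conductances d) (x y : Site d) : ℝ := ω.weight x y / ω.vertexWeight x

/-- The law of one step of the random walk from `x`. -/
def stepMeasure (ω : Conductances d) (x : Site d) : Measure (Site d) :=
  ∑ y ∈ x.neighbors, ENNReal.ofReal (ω.transProb x y) • Measure.dirac y

instance isProbabilityMeasure_stepMeasure [NeZero d] (ω : Conductances d) (x : Site d) :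
    IsProbabilityMeasure (ω.stepMeasure x) := by
  constructor
  simp only [stepMeasure, Measure.coe_finsetSum, Finset.sum_apply, Measure.smul_apply,
    measure_univ, smul_eq_mul, mul_one]
  simp only [transProb]
  rw [← ENNReal.ofReal_sum_of_nonneg
    (fun y _ => div_nonneg (ω.weight_nonneg x y) (ω.vertexWeight_pos x).le)]
  rw [← Finset.sum_div]
  change ENNReal.ofReal (ω.vertexWeight x / ω.vertexWeight x) = 1
  rw [div_self (ω.vertexWeight_pos x).ne', ENNReal.ofReal_one]

/-- The transition kernel of the random walk on the state space `ℤ^d`. -/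
def stepKernel (ω : Conductances d) : Kernel (Site d) (Site d) :=
  Kernel.ofFunOfCountable ω.stepMeasure

instance isMarkovKernel_stepKernel [NeZero d] (ω : Conductances d) :
    IsMarkovKernel ω.stepKernel :=
  ⟨fun x => ω.isProbabilityMeasure_stepMeasure x⟩

/-- The conditional law of `X_{n+1}` given `X_0, …, X_n`; it depends on `X_n` only. -/
def historyKernel (ω : Conductances d) (n : ℕ) :
    Kernel ((_ : Finset.Iic n) → Site d) (Site d) :=
  ω.stepKernel.comap (fun h => h ⟨n, Finset.mem_Iic.2 le_rfl⟩) (measurable_pi_apply _)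

instance isMarkovKernel_historyKernel [NeZero d] (ω : Conductances d) (n : ℕ) :
    IsMarkovKernel (ω.historyKernel n) := by
  unfold historyKernel
  infer_instance

/-- The law `P_ω^x` on trajectories `X : ℕ → ℤ^d` of the random walk started at `x`. -/
def walkLaw [NeZero d] (ω : Conductances d) (x : Site d) : Measure (ℕ → Site d) :=
  Kernel.trajMeasure (X := fun _ => Site d) (Measure.dirac x) ω.historyKernel

instance isProbabilityMeasure_walkLaw [NeZero d] (ω : Conductances d) (x : Site d) :
    IsProbabilityMeasure (ω.walkLaw x) := by
  unfold walkLaw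
  infer_instance

/-- The set `Ω_{p,q}`: the normalized sums over `E(Λ_n)` of `c_ω(e)^p` and of `c_ω(e)^{-q}` are
bounded over `n ≥ 1`. -/
def momentClass (d : ℕ) (p q : ℝ) : Set (Conductances d) :=
  {ω | BddAbove ((fun n : ℕ => (1 / (n : ℝ) ^ d) *
          ∑ e ∈ LatticeEdge.incidentFinset (Site.box d n), ω.c e ^ p) '' Set.Ici 1) ∧
       BddAbove ((fun n : ℕ => (1 / (n : ℝ) ^ d) *
          ∑ e ∈ LatticeEdge.incidentFinset (Site.box d n), ω.c e ^ (-q)) '' Set.Ici 1)}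

end Conductances

/-- The path space `C([0,∞), ℝ^d)`. Mathlib's topology on it is the compact-open topology, that
is, the topology of locally uniform convergence. -/
abbrev PathSpace (d : ℕ) : Type := C(ℝ≥0, Fin d → ℝ)

instance PathSpace.measurableSpace (d : ℕ) : MeasurableSpace (PathSpace d) := borel _

instance PathSpace.borelSpace (d : ℕ) : BorelSpace (PathSpace d) := ⟨rfl⟩

/-- A lattice site as a point of `ℝ^d`. -/
def Site.toReal {d : ℕ} (x : Site d) : Fin d → ℝ := fun i => (x i : ℝ)

/-- Linear interpolation at time `s` of a sequence of lattice sites. -/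
def interpolate {d : ℕ} (X : ℕ → Site d) (s : ℝ≥0) : Fin d → ℝ :=
  (X ⌊s⌋₊).toReal + ((s : ℝ) - (⌊s⌋₊ : ℝ)) • ((X (⌊s⌋₊ + 1)).toReal - (X ⌊s⌋₊).toReal)

theorem continuous_interpolate {d : ℕ} :
    Continuous fun z : (ℕ → Site d) × ℝ≥0 => interpolate z.1 z.2 := by
  have hR : Continuous (Site.toReal (d := d)) := continuous_pi fun i =>
    continuous_of_discreteTopology.comp (continuous_apply i)
  let F : ℕ → Set ((ℕ → Site d) × ℝ≥0) := fun k => {z | (k : ℝ≥0) ≤ z.2 ∧ z.2 ≤ k + 1}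
  have hfin : LocallyFinite F := by
    intro z
    refine ⟨{w | w.2 < z.2 + 1},
      (isOpen_lt continuous_snd continuous_const).mem_nhds (by simp), ?_⟩
    refine (Set.finite_Iic ⌈z.2 + 1⌉₊).subset ?_
    rintro k ⟨w, hw, hw'⟩
    have h1 : (k : ℝ≥0) < z.2 + 1 := lt_of_le_of_lt hw.1 hw'
    exact_mod_cast (h1.trans_le (Nat.le_ceil _)).le
  refine hfin.continuous ?_ ?_ ?_
  · refine Set.eq_univ_of_forall fun z => Set.mem_iUnion.2 ⟨⌊z.2⌋₊, ?_, ?_⟩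
    · exact Nat.floor_le (zero_le)
    · exact (Nat.lt_floor_add_one z.2).le
  · intro k
    have h1 : IsClosed {z : (ℕ → Site d) × ℝ≥0 | (k : ℝ≥0) ≤ z.2} :=
      isClosed_le continuous_const continuous_snd
    have h2 : IsClosed {z : (ℕ → Site d) × ℝ≥0 | z.2 ≤ (k : ℝ≥0) + 1} :=
      isClosed_le continuous_snd continuous_const
    exact h1.inter h2
  · intro k
    have hk : ∀ m : ℕ, Continuous fun z : (ℕ → Site d) × ℝ≥0 => (z.1 m).toReal := fun m =>
      hR.comp ((continuous_apply m).comp continuous_fst)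
    have hc : Continuous fun z : (ℕ → Site d) × ℝ≥0 =>
        (z.1 k).toReal + ((z.2 : ℝ) - (k : ℝ)) • ((z.1 (k + 1)).toReal - (z.1 k).toReal) :=
      (hk k).add (((NNReal.continuous_coe.comp continuous_snd).sub continuous_const).smul
        ((hk (k + 1)).sub (hk k)))
    refine hc.continuousOn.congr ?_
    rintro ⟨X, s⟩ ⟨h1, h2⟩
    dsimp only at h1 h2 ⊢
    rcases h2.lt_or_eq with h | h
    · have : ⌊s⌋₊ = k := (Nat.floor_eq_iff (zero_le)).2 ⟨h1, h⟩
      simp [interpolate, this]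
    · have : ⌊s⌋₊ = k + 1 := by
        rw [h]
        exact_mod_cast Nat.floor_natCast (k + 1)
      rw [interpolate, this, h]
      simp

/-- The diffusively rescaled, linearly interpolated path
`B^{(n)}_t = n^{-1/2} (X_{⌊tn⌋} + (tn - ⌊tn⌋) (X_{⌊tn⌋+1} - X_{⌊tn⌋}))`. -/
def rescaledPath {d : ℕ} (n : ℕ) (X : ℕ → Site d) : PathSpace d where
  toFun t := (1 / Real.sqrt n) • interpolate X (t * n)
  continuous_toFun := by
    have h : Continuous fun t : ℝ≥0 => interpolate X (t * n) := continuous_interpolate.comp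
      (continuous_const.prodMk (continuous_id.mul continuous_const))
    exact h.const_smul (1 / Real.sqrt n)

theorem measurable_rescaledPath {d : ℕ} (n : ℕ) :
    Measurable (rescaledPath n : (ℕ → Site d) → PathSpace d) := by
  refine Continuous.measurable (ContinuousMap.continuous_of_continuous_uncurry _ ?_)
  have h : Continuous fun z : (ℕ → Site d) × ℝ≥0 => interpolate z.1 (z.2 * n) :=
    continuous_interpolate.comp
      (continuous_fst.prodMk (continuous_snd.mul continuous_const))
  exact h.const_smul (1 / Real.sqrt n)

namespace Conductances

/-- The law `P^{(n,ω)}` of `B^{(n)}` under `P_ω^0` on the path space. -/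
def pathLaw {d : ℕ} [NeZero d] (ω : Conductances d) (n : ℕ) : Measure (PathSpace d) :=
  (ω.walkLaw 0).map (rescaledPath n)

instance isProbabilityMeasure_pathLaw {d : ℕ} [NeZero d] (ω : Conductances d) (n : ℕ) :
    IsProbabilityMeasure (ω.pathLaw n) :=
  Measure.isProbabilityMeasure_map (measurable_rescaledPath n).aemeasurable

end Conductances

end

/-! The moment bounds are deterministic, and the argument is a De Giorgi iteration carried out for
one fixed environment. Tightness reduces to a bound on quick exits: from any starting point within
`O(√n)` of the origin, the walk must be unlikely to leave a ball of radius `ε√n` within about `n /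
D` steps.

Discounting exit probabilities at rate `κ = 1 / k` produces a function `0 ≤ v ≤ 1` with `(1 + κ) v ≤
P v` in the ball. Subtract the cone `ψ = |x - x₀|₁ / r`. Since `v ≤ 1`, the difference `v - ψ` is
positive only inside the ball, so its truncations are admissible test functions. With `A_k = {v - ψ
> k}`, `energy_truncation_le` bounds both the Dirichlet energy of the truncation and a killing term
by a multiple of `r⁻² π(A_k)`. Cauchy–Schwarz against the resistances and the `ℓ¹` Sobolev
inequality turn the energy bound into `(h - k)² |A_h|^(2 - 2/d) ≤ C r⁻² π(A_k) ρ(A_k)`, where `ρ`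
sums the inverse conductances. By Hölder, after normalization by the volume, the right side is of
order `|A_k|^(2 - 1/p - 1/q)`. The condition on `p, q` says precisely that this exponent exceeds `2
- 2/d`, so Stampacchia's lemma empties some superlevel set. The killing term makes the first level
small, and `exists_subsolution_le` follows: `v x₀ ≤ C (κ L²)^(-γ)` with some small `γ > 0`.

A small `γ` would not survive a union bound over time blocks. Crossing `m` nested balls raises the
estimate to the power `m`; with `γ m ≥ 2` each block of length about `n / D` fails with probability
`O(D⁻²)`, and there are only `O(D)` blocks. Moments are controlled only in boxes about the origin,
so the walk is first confined to a ball of radius `O(√n)`; this is the exit bound with `m = 1` and a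
large radius. Arzelà–Ascoli converts the resulting modulus of continuity into tightness. -/

/-! ### The `ℓ¹` Sobolev inequality on the lattice. -/

/-- Telescoping from a zero to the left of `a`. This is the one-dimensional estimate applied along
each coordinate line. -/
theorem ENNReal.ofReal_abs_le_tsum_abs_sub {g : ℤ → ℝ} {m a : ℤ} (hm : m ≤ a) (h0 : g m = 0) :
    ENNReal.ofReal |g a| ≤ ∑' t : ℤ, ENNReal.ofReal |g t - g (t + 1)| := by
  obtain ⟨n, rfl⟩ : ∃ n : ℕ, a = m + n := ⟨(a - m).toNat, by omega⟩
  have key : ∀ n : ℕ, ENNReal.ofReal |g (m + n)| ≤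
      ∑ j ∈ Finset.range n, ENNReal.ofReal |g (m + j) - g (m + j + 1)| := by
    intro n
    induction n with
    | zero => simp [h0]
    | succ n ih =>
      rw [Finset.sum_range_succ]
      refine le_trans ?_ (add_le_add_left ih _)
      rw [← ENNReal.ofReal_add (abs_nonneg _) (abs_nonneg _)]
      refine ENNReal.ofReal_le_ofReal ?_
      have h1 := abs_sub_abs_le_abs_sub (g (m + n + 1)) (g (m + n))
      have h2 := abs_sub_comm (g (m + n + 1)) (g (m + n))
      push_cast
      rw [← add_assoc]
      linarith
  refine (key n).trans ?_
  refine (ENNReal.sum_le_tsum _).trans ?_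
  exact ENNReal.tsum_comp_le_tsum_of_injective
    (f := fun j : ℕ => m + (j : ℤ)) (fun a b h => by simpa using h)
    (fun t => ENNReal.ofReal |g t - g (t + 1)|)

namespace Site

theorem lintegral_pi_count {d : ℕ} (f : Site d → ℝ≥0∞) :
    ∫⁻ x, f x ∂(Measure.pi fun _ : Fin d => (Measure.count : Measure ℤ)) = ∑' x, f x := by
  rw [lintegral_countable']
  refine tsum_congr fun x => ?_
  rw [Measure.pi_singleton]
  simp

theorem adj_update_succ {d : ℕ} (x : Site d) (i : Fin d) (t : ℤ) :
    Adj (Function.update x i t) (Function.update x i (t + 1)) := by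
  unfold Adj
  rw [Finset.sum_eq_single i]
  · simp
  · intro b _ hb
    simp [hb]
  · simp

/-- The `ℓ¹` Sobolev inequality on `ℤ^d`. -/
theorem tsum_rpow_le_tsum_gradient_rpow {d : ℕ} (hd : 2 ≤ d) (w : Site d → ℝ) (F : Finset (Site d))
    (hF : ∀ x ∉ F, w x = 0) :
    ∑' x, ENNReal.ofReal |w x| ^ ((d : ℝ) / (d - 1)) ≤
      (∑' x, ∑ y ∈ neighbors x, ENNReal.ofReal |w x - w y|) ^ ((d : ℝ) / (d - 1)) := by
  classical
  have hd' : (2 : ℝ) ≤ d := by exact_mod_cast hd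
  set f : Site d → ℝ≥0∞ := fun x => ∑ y ∈ neighbors x, ENNReal.ofReal |w x - w y| with hf
  have hconj : Real.HolderConjugate (Fintype.card (Fin d) : ℝ) ((d : ℝ) / (d - 1)) := by
    rw [Fintype.card_fin]
    exact Real.HolderConjugate.conjExponent (by linarith)
  -- The Gagliardo–Nirenberg grid-lines inequality for counting measure, applied to the local
  -- gradient sum `f`. It remains to bound `|w x|` by the sum of `f` over each of the `d` lines
  -- through `x`.
  have h := lintegral_prod_lintegral_pow_le (fun _ : Fin d => (Measure.count : Measure ℤ))
    hconj (f := f) (measurable_of_countable f)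
  rw [lintegral_pi_count, lintegral_pi_count] at h
  refine le_trans (ENNReal.tsum_le_tsum fun x => ?_) h
  have hi : ∀ i : Fin d, ENNReal.ofReal |w x| ≤
      ∫⁻ t, f (Function.update x i t) ∂(Measure.count : Measure ℤ) := by
    intro i
    rw [lintegral_count]
    -- The half-line to the left of `x` is infinite, so it leaves the finite set `F`, where `w`
    -- vanishes.
    obtain ⟨m, hm, hm0⟩ : ∃ m : ℤ, m ≤ x i ∧ w (Function.update x i m) = 0 := by
      by_contra hcon
      push Not at hcon
      refine (Set.Iic_infinite (x i)) ?_
      have : Set.MapsTo (fun m => Function.update x i m) (Set.Iic (x i)) (F : Set (Site d)) := by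
        intro m hm
        by_contra hmF
        exact hcon m hm (hF _ hmF)
      exact Set.Finite.of_finite_image (F.finite_toSet.subset this.image_subset)
        (Function.update_injective x i).injOn
    have := ENNReal.ofReal_abs_le_tsum_abs_sub (g := fun t => w (Function.update x i t)) hm hm0
    simp only [Function.update_eq_self] at this
    refine this.trans (ENNReal.tsum_le_tsum fun t => ?_)
    exact Finset.single_le_sum
      (f := fun y => ENNReal.ofReal |w (Function.update x i t) - w y|) (fun _ _ => zero_le)
      (mem_neighbors.2 (adj_update_succ x i t))
  calc ENNReal.ofReal |w x| ^ ((d : ℝ) / (d - 1))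
      = ∏ _i : Fin d, ENNReal.ofReal |w x| ^ ((1 : ℝ) / (d - 1)) := by
        rw [Finset.prod_const, Finset.card_univ, Fintype.card_fin, ← ENNReal.rpow_natCast,
          ← ENNReal.rpow_mul]
        congr 1
        ring
    _ ≤ _ := by
        refine Finset.prod_le_prod' fun i _ => ?_
        rw [Fintype.card_fin]
        exact ENNReal.rpow_le_rpow (hi i) (div_nonneg zero_le_one (by linarith))

/-- A weak form of the `ℓ¹` Sobolev inequality on `ℤ^d`, for the superlevel sets of `w`. -/
theorem mul_card_rpow_le_sum_gradient {d : ℕ} (hd : 2 ≤ d) {w : Site d → ℝ} {F S : Finset (Site d)}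
    (hF : ∀ x ∉ F, w x = 0 ∧ ∀ y ∈ neighbors x, w y = 0) {t : ℝ} (ht : 0 ≤ t)
    (hS : ∀ x ∈ S, t ≤ w x) :
    t * (S.card : ℝ) ^ (1 - 1 / (d : ℝ)) ≤ ∑ x ∈ F, ∑ y ∈ neighbors x, |w x - w y| := by
  have hd' : (2 : ℝ) ≤ d := by exact_mod_cast hd
  have h := tsum_rpow_le_tsum_gradient_rpow hd w F fun x hx => (hF x hx).1
  set P : ℝ := (d : ℝ) / (d - 1) with hP
  have hP0 : 0 < P := div_pos (by linarith) (by linarith)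
  have hright : (∑' x, ∑ y ∈ neighbors x, ENNReal.ofReal |w x - w y|) =
      ENNReal.ofReal (∑ x ∈ F, ∑ y ∈ neighbors x, |w x - w y|) := by
    rw [tsum_eq_sum (s := F), ENNReal.ofReal_sum_of_nonneg]
    · refine Finset.sum_congr rfl fun x _ => ?_
      rw [ENNReal.ofReal_sum_of_nonneg fun _ _ => abs_nonneg _]
    · exact fun _ _ => Finset.sum_nonneg fun _ _ => abs_nonneg _
    · intro x hx
      refine Finset.sum_eq_zero fun y hy => ?_
      rw [(hF x hx).1, (hF x hx).2 y hy]
      simp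
  have hleft : ENNReal.ofReal (S.card * t ^ P) ≤ ∑' x, ENNReal.ofReal |w x| ^ P := by
    refine le_trans ?_ (ENNReal.sum_le_tsum S)
    rw [ENNReal.ofReal_mul (Nat.cast_nonneg _), ENNReal.ofReal_natCast, ← nsmul_eq_mul]
    refine Finset.card_nsmul_le_sum _ _ _ fun x hx => ?_
    rw [← ENNReal.ofReal_rpow_of_nonneg ht hP0.le]
    exact ENNReal.rpow_le_rpow
      (ENNReal.ofReal_le_ofReal ((hS x hx).trans (le_abs_self _))) hP0.le
  have hnn : 0 ≤ ∑ x ∈ F, ∑ y ∈ neighbors x, |w x - w y| :=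
    Finset.sum_nonneg fun _ _ => Finset.sum_nonneg fun _ _ => abs_nonneg _
  have h2 : (S.card : ℝ) * t ^ P ≤ (∑ x ∈ F, ∑ y ∈ neighbors x, |w x - w y|) ^ P := by
    have := hleft.trans h
    rw [hright, ENNReal.ofReal_rpow_of_nonneg hnn hP0.le] at this
    exact (ENNReal.ofReal_le_ofReal_iff (Real.rpow_nonneg hnn _)).1 this
  refine (Real.rpow_le_rpow_iff (by positivity) hnn hP0).1 (le_trans (le_of_eq ?_) h2)
  rw [Real.mul_rpow ht (by positivity), ← Real.rpow_mul (Nat.cast_nonneg _), mul_comm]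
  congr 1
  have : (1 - 1 / (d : ℝ)) * P = 1 := by
    rw [hP]
    have : (d : ℝ) - 1 ≠ 0 := by linarith
    field_simp
  rw [this, Real.rpow_one]

end Site

/-! ### Level iteration. -/

/-- Stampacchia's lemma: fast geometric decay of the levels of an antitone function. -/
theorem eq_zero_of_sq_mul_le_rpow {g : ℝ → ℝ} (hg0 : ∀ k, 0 ≤ g k) (hg : Antitone g) {C b k₀ D : ℝ}
    (hC : 0 ≤ C) (hb : 1 < b) (hD : 0 < D)
    (hrec : ∀ k h, k₀ ≤ k → k < h → (h - k) ^ 2 * g h ≤ C * g k ^ b)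
    (hsmall : C * 4 * 4 ^ (1 / (b - 1)) * g k₀ ^ (b - 1) ≤ D ^ 2) : g (k₀ + D) = 0 := by
  -- `M` is the decay ratio for which `M ^ (b - 1) = 4`: the superlinear gain then cancels the loss
  -- `4 ^ j` caused by the gaps between the levels `k j`, which shrink like `2 ^ (-j)`.
  set M : ℝ := 4 ^ (1 / (b - 1)) with hM
  have hM0 : 0 < M := Real.rpow_pos_of_pos (by norm_num) _
  have hM1 : 1 < M := Real.one_lt_rpow (by norm_num) (div_pos one_pos (by linarith))
  have hMb : M ^ (b - 1) = 4 := by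
    rw [hM, ← Real.rpow_mul (by norm_num), one_div, inv_mul_cancel₀ (by linarith), Real.rpow_one]
  set k : ℕ → ℝ := fun j => k₀ + D * (1 - (1 / 2) ^ j) with hk
  have hdecay : ∀ j, g (k j) ≤ g k₀ * (M⁻¹) ^ j := by
    intro j
    induction j with
    | zero => simp [hk]
    | succ j ih =>
      have hp : (0 : ℝ) < (1 / 2) ^ j := by positivity
      have hp1 : ((1 : ℝ) / 2) ^ j ≤ 1 := pow_le_one₀ (by norm_num) (by norm_num)
      have hd : k (j + 1) - k j = D * (1 / 2) ^ j / 2 := by simp only [hk, pow_succ]; ring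
      have h := hrec (k j) (k (j + 1)) (by simp only [hk]; nlinarith) (by
        have : 0 < k (j + 1) - k j := by rw [hd]; positivity
        linarith)
      rw [hd] at h
      have hb1 : g (k j) ^ b ≤ g k₀ * g k₀ ^ (b - 1) * (M⁻¹ ^ j * (1 / 4) ^ j) := by
        calc g (k j) ^ b ≤ (g k₀ * (M⁻¹) ^ j) ^ b := Real.rpow_le_rpow (hg0 _) ih (by linarith)
          _ = g k₀ ^ b * ((M⁻¹) ^ j) ^ b := Real.mul_rpow (hg0 _) (by positivity)
          _ = _ := by
            have e1 : ∀ x : ℝ, 0 ≤ x → x ^ b = x * x ^ (b - 1) := by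
              intro x hx
              rw [mul_comm, ← Real.rpow_add_one' hx (by linarith)]
              congr 1
              ring
            rw [e1 _ (hg0 _), e1 _ (by positivity), ← Real.rpow_natCast, ← Real.rpow_mul
              (by positivity), mul_comm (j : ℝ) (b - 1), Real.rpow_mul (by positivity),
              Real.inv_rpow hM0.le (b - 1), hMb, Real.rpow_natCast, Real.rpow_natCast]
            norm_num
      have h4 : (D * (1 / 2) ^ j / 2) ^ 2 = D ^ 2 * (1 / 4) ^ j / 4 := by
        rw [div_pow, mul_pow, ← pow_mul, mul_comm j 2, pow_mul]
        norm_num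
      rw [h4] at h
      have hq : (0 : ℝ) < (1 / 4) ^ j := by positivity
      have h5 : D ^ 2 * g (k (j + 1)) ≤ D ^ 2 * (g k₀ * M⁻¹ ^ (j + 1)) := by
        have h6 : (1 / 4 : ℝ) ^ j * (D ^ 2 * g (k (j + 1))) ≤
            (1 / 4) ^ j * (4 * C * (g k₀ * g k₀ ^ (b - 1) * M⁻¹ ^ j)) := by
          nlinarith [mul_le_mul_of_nonneg_left hb1 hC]
        refine (le_of_mul_le_mul_left h6 hq).trans ?_
        have h7 := mul_le_mul_of_nonneg_left hsmall
          (mul_nonneg (hg0 k₀) (pow_nonneg (inv_nonneg.2 hM0.le) (j + 1)))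
        have h8 : M * M⁻¹ ^ (j + 1) = M⁻¹ ^ j := by
          rw [pow_succ, mul_comm, mul_assoc, inv_mul_cancel₀ hM0.ne', mul_one]
        rw [← h8]
        nlinarith
      exact le_of_mul_le_mul_left h5 (by positivity)
  refine le_antisymm ?_ (hg0 _)
  refine ge_of_tendsto' (x := Filter.atTop) (f := fun j : ℕ => g k₀ * M⁻¹ ^ j) ?_ fun j => ?_
  · simpa using (tendsto_pow_atTop_nhds_zero_of_lt_one (inv_nonneg.2 hM0.le)
      (inv_lt_one_of_one_lt₀ hM1)).const_mul (g k₀)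
  · refine le_trans (hg ?_) (hdecay j)
    have hp : (0 : ℝ) < (1 / 2) ^ j := by positivity
    simp only [hk]
    nlinarith

/-! ### Boxes, Hölder's inequality and moment bounds. -/

namespace Site

variable {d : ℕ}

theorem mem_box {n : ℕ} {x : Site d} : x ∈ box d n ↔ ∀ i, -(n : ℤ) ≤ x i ∧ x i ≤ n := by
  simp [box]

theorem mem_box_succ_of_adj {n : ℕ} {x y : Site d} (h : Adj x y) (hx : x ∈ box d n) :
    y ∈ box d (n + 1) := by
  rw [mem_box] at hx ⊢
  intro i
  have h1 := abs_le.1 (h.abs_le i)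
  have h2 := hx i
  push_cast
  constructor <;> linarith [h1.1, h1.2, h2.1, h2.2]

theorem card_neighbors_le (x : Site d) : (neighbors x).card ≤ 3 ^ d := by
  classical
  refine (Finset.card_filter_le _ _).trans ?_
  rw [Fintype.card_piFinset]
  simp only [Int.card_Icc]
  rw [Finset.prod_congr rfl (g := fun _ => 3) fun i _ => by ring_nf; rfl]
  simp

theorem card_box_le {n : ℕ} (hn : 1 ≤ n) : ((box d n).card : ℝ) ≤ 3 ^ d * (n : ℝ) ^ d := by
  have : (box d n).card = (2 * n + 1) ^ d := by
    unfold box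
    rw [Fintype.card_piFinset]
    simp only [Int.card_Icc, Finset.prod_const, Finset.card_univ, Fintype.card_fin]
    congr 1
    omega
  rw [this, ← mul_pow]
  push_cast
  have : (1 : ℝ) ≤ n := by exact_mod_cast hn
  gcongr
  linarith

/-- Hölder's inequality for sums over the edges that start in a finite set. -/
theorem sum_neighbors_le_rpow {a : ℝ} (ha : 1 ≤ a) {φ : Site d → Site d → ℝ}
    (hφ : ∀ x y, Adj x y → 0 ≤ φ x y) {n : ℕ} {A : Finset (Site d)} (hA : A ⊆ box d n) {K : ℝ}
    (hK : ∑ e ∈ LatticeEdge.incidentFinset (box d n), φ e.1.1 e.1.2 ^ a ≤ K) :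
    ∑ x ∈ A, ∑ y ∈ neighbors x, φ x y ≤ K ^ (1 / a) * (3 ^ d * (A.card : ℝ)) ^ (1 - 1 / a) := by
  classical
  have ha0 : 0 < a := by linarith
  set T := A.sigma neighbors with hT
  have hmem : ∀ z ∈ T, Adj z.1 z.2 := fun z hz => mem_neighbors.1 (Finset.mem_sigma.1 hz).2
  have hnn : ∀ z ∈ T, 0 ≤ φ z.1 z.2 := fun z hz => hφ _ _ (hmem z hz)
  have h1 : (∑ z ∈ T, φ z.1 z.2) ^ a ≤ (T.card : ℝ) ^ (a - 1) * ∑ z ∈ T, φ z.1 z.2 ^ a :=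
    Real.rpow_sum_le_const_mul_sum_rpow_of_nonneg T ha hnn
  have h2 : ∑ z ∈ T, φ z.1 z.2 ^ a ≤ K := by
    refine le_trans ?_ hK
    set g : {z // z ∈ T} → LatticeEdge d := fun z => ⟨(z.1.1, z.1.2), hmem z.1 z.2⟩ with hg
    have hinj : Set.InjOn g (T.attach : Set {z // z ∈ T}) := by
      rintro ⟨⟨x, y⟩, hz⟩ - ⟨⟨x', y'⟩, hz'⟩ - h
      have := Subtype.ext_iff.1 h
      simp only [hg, Prod.mk.injEq] at this
      obtain ⟨rfl, rfl⟩ := this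
      rfl
    rw [← Finset.sum_attach,
      ← Finset.sum_image (f := fun e : LatticeEdge d => φ e.1.1 e.1.2 ^ a) hinj]
    refine Finset.sum_le_sum_of_subset_of_nonneg ?_ fun e _ _ => Real.rpow_nonneg (hφ _ _ e.2) _
    intro e he
    obtain ⟨z, -, rfl⟩ := Finset.mem_image.1 he
    refine (LatticeEdge.finite_incident _).mem_toFinset.2 (Or.inl ?_)
    exact hA (Finset.mem_sigma.1 z.2).1
  have hcard : (T.card : ℝ) ≤ 3 ^ d * A.card := by
    have : T.card ≤ 3 ^ d * A.card := by
      rw [hT, Finset.card_sigma, mul_comm, ← smul_eq_mul]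
      exact Finset.sum_le_card_nsmul _ _ _ fun x _ => card_neighbors_le x
    exact_mod_cast this
  have hK0 : 0 ≤ K := le_trans (Finset.sum_nonneg fun z hz => Real.rpow_nonneg (hnn z hz) _) h2
  have hs0 : 0 ≤ ∑ z ∈ T, φ z.1 z.2 := Finset.sum_nonneg hnn
  have h3 : (∑ z ∈ T, φ z.1 z.2) ^ a ≤ (3 ^ d * (A.card : ℝ)) ^ (a - 1) * K :=
    h1.trans (mul_le_mul (Real.rpow_le_rpow (Nat.cast_nonneg _) hcard (by linarith)) h2
      (Finset.sum_nonneg fun z hz => Real.rpow_nonneg (hnn z hz) _) (by positivity))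
  rw [Finset.sum_sigma']
  refine (Real.rpow_le_rpow_iff hs0 (by positivity) ha0).1 (h3.trans (le_of_eq ?_))
  rw [Real.mul_rpow (x := K ^ (1 / a)) (by positivity) (by positivity), ← Real.rpow_mul hK0,
    ← Real.rpow_mul (by positivity), one_div, inv_mul_cancel₀ ha0.ne', Real.rpow_one, mul_comm]
  congr 2
  field_simp

end Site

namespace Conductances

variable {d : ℕ}

theorem weight_comm (ω : Conductances d) (x y : Site d) : ω.weight x y = ω.weight y x := by
  unfold weight
  by_cases h : Site.Adj x y
  · rw [dif_pos h, dif_pos h.symm]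
    exact ω.symm ⟨(y, x), h.symm⟩
  · rw [dif_neg h, dif_neg fun h' => h h'.symm]

theorem weight_eq_zero (ω : Conductances d) {x y : Site d} (h : ¬ Site.Adj x y) :
    ω.weight x y = 0 := dif_neg h

theorem weight_edge (ω : Conductances d) (e : LatticeEdge d) : ω.weight e.1.1 e.1.2 = ω.c e :=
  dif_pos e.2

/-- The sum of the inverse conductances of the edges `(x, z)`. -/
noncomputable def vertexResistance (ω : Conductances d) (x : Site d) : ℝ :=
  ∑ z ∈ x.neighbors, (ω.weight x z)⁻¹

theorem vertexResistance_nonneg (ω : Conductances d) (x : Site d) : 0 ≤ ω.vertexResistance x :=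
  Finset.sum_nonneg fun _ _ => inv_nonneg.2 (ω.weight_nonneg _ _)

/-- A single edge at `x` already gives the bound. It lets the lower moment control unweighted sums
by sums weighted with `π_ω`. -/
theorem inv_vertexWeight_le [NeZero d] (ω : Conductances d) (x : Site d) :
    (ω.vertexWeight x)⁻¹ ≤ ω.vertexResistance x := by
  obtain ⟨y, hy⟩ := x.neighbors_nonempty
  have h1 : ω.weight x y ≤ ω.vertexWeight x :=
    Finset.single_le_sum (f := fun z => ω.weight x z) (fun _ _ => ω.weight_nonneg _ _) hy
  refine (inv_anti₀ (ω.weight_pos (Site.mem_neighbors.1 hy)) h1).trans ?_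
  exact Finset.single_le_sum (f := fun z => (ω.weight x z)⁻¹)
    (fun _ _ => inv_nonneg.2 (ω.weight_nonneg _ _)) hy

/-- The bounds `K n^d` on the moments of the conductances in boxes centred at the origin. -/
structure MomentBound (ω : Conductances d) (p q K : ℝ) : Prop where
  one_le : 1 ≤ K
  upper : ∀ n : ℕ, 1 ≤ n →
    ∑ e ∈ LatticeEdge.incidentFinset (Site.box d n), ω.c e ^ p ≤ K * (n : ℝ) ^ d
  lower : ∀ n : ℕ, 1 ≤ n →
    ∑ e ∈ LatticeEdge.incidentFinset (Site.box d n), ω.c e ^ (-q) ≤ K * (n : ℝ) ^ d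

theorem exists_momentBound {ω : Conductances d} {p q : ℝ} (hω : ω ∈ momentClass d p q) :
    ∃ K, ω.MomentBound p q K := by
  obtain ⟨⟨K₁, h₁⟩, ⟨K₂, h₂⟩⟩ := hω
  have aux : ∀ (K S : ℝ) (n : ℕ), 1 ≤ n → 1 / (n : ℝ) ^ d * S ≤ K →
      S ≤ max 1 (max K₁ K₂) * (n : ℝ) ^ d ∨ max K₁ K₂ < K := by
    intro K S n hn h
    by_cases hK : max K₁ K₂ < K
    · exact Or.inr hK
    · left
      have hn' : (0 : ℝ) < (n : ℝ) ^ d := by positivity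
      rw [one_div, inv_mul_le_iff₀ hn', mul_comm] at h
      refine h.trans ?_
      gcongr
      exact (not_lt.1 hK).trans (le_max_right _ _)
  refine ⟨max 1 (max K₁ K₂), le_max_left _ _, fun n hn => ?_, fun n hn => ?_⟩
  · exact (aux K₁ _ n hn (h₁ ⟨n, hn, rfl⟩)).resolve_right (not_lt.2 (le_max_left _ _))
  · exact (aux K₂ _ n hn (h₂ ⟨n, hn, rfl⟩)).resolve_right (not_lt.2 (le_max_right _ _))

/-- Hölder with exponents `p` and `q` gives the two factors the powers `1 - 1/p` and `1 - 1/q` of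
the density of `A` in the box. Their sum is the exponent that has to beat `2 - 2/d`. The crude
constants use `K ≥ 1` and at most `3 ^ d` neighbours per site. -/
theorem MomentBound.sum_mul_sum_le {ω : Conductances d} {p q K : ℝ} (h : ω.MomentBound p q K)
    (hp : 1 ≤ p) (hq : 1 ≤ q) {n : ℕ} (hn : 1 ≤ n) {A : Finset (Site d)} (hA : A ⊆ Site.box d n) :
    (∑ x ∈ A, ω.vertexWeight x) * ∑ x ∈ A, ω.vertexResistance x ≤
      K ^ 2 * 9 ^ d * (n : ℝ) ^ (2 * d) * (A.card / (n : ℝ) ^ d) ^ (2 - (1 / p + 1 / q)) := by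
  have hn' : (0 : ℝ) < (n : ℝ) ^ d := by positivity
  have hK := h.one_le
  have hp' : 1 / p ≤ 1 := by rw [div_le_one (by linarith)]; exact hp
  have hq' : 1 / q ≤ 1 := by rw [div_le_one (by linarith)]; exact hq
  have key : ∀ {a : ℝ}, 1 ≤ a → ∀ {φ : Site d → Site d → ℝ}, (∀ x y, Site.Adj x y → 0 ≤ φ x y) →
      ∑ e ∈ LatticeEdge.incidentFinset (Site.box d n), φ e.1.1 e.1.2 ^ a ≤ K * (n : ℝ) ^ d →
      ∑ x ∈ A, ∑ y ∈ x.neighbors, φ x y ≤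
        K * 3 ^ d * (n : ℝ) ^ d * (A.card / (n : ℝ) ^ d) ^ (1 - 1 / a) := by
    intro a ha φ hφ hb
    have ha' : 1 / a ≤ 1 := by rw [div_le_one (by linarith)]; exact ha
    have ha0 : 0 ≤ 1 / a := by positivity
    refine (Site.sum_neighbors_le_rpow ha hφ hA hb).trans ?_
    rw [Real.mul_rpow (by positivity) (by positivity), Real.mul_rpow (by positivity) (by positivity),
      Real.div_rpow (by positivity) (by positivity)]
    have e1 : K ^ (1 / a) ≤ K := by
      simpa using Real.rpow_le_rpow_of_exponent_le hK ha'
    have e2 : ((3 : ℝ) ^ d) ^ (1 - 1 / a) ≤ 3 ^ d := by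
      simpa using Real.rpow_le_rpow_of_exponent_le (x := (3 : ℝ) ^ d)
        (one_le_pow₀ (by norm_num)) (by linarith : 1 - 1 / a ≤ 1)
    have e3 : (n : ℝ) ^ d * (((A.card : ℝ) ^ (1 - 1 / a)) / ((n : ℝ) ^ d) ^ (1 - 1 / a)) =
        ((n : ℝ) ^ d) ^ (1 / a) * (A.card : ℝ) ^ (1 - 1 / a) := by
      rw [Real.rpow_sub hn' 1 (1 / a), Real.rpow_one]
      have : 0 < ((n : ℝ) ^ d) ^ (1 / a) := by positivity
      field_simp
    rw [mul_assoc _ ((n : ℝ) ^ d), e3]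
    calc K ^ (1 / a) * ((n : ℝ) ^ d) ^ (1 / a) *
          (((3 : ℝ) ^ d) ^ (1 - 1 / a) * (A.card : ℝ) ^ (1 - 1 / a))
        = K ^ (1 / a) * ((3 : ℝ) ^ d) ^ (1 - 1 / a) *
          (((n : ℝ) ^ d) ^ (1 / a) * (A.card : ℝ) ^ (1 - 1 / a)) := by ring
      _ ≤ _ := by gcongr
  have h1 := key hp (φ := ω.weight) (fun x y _ => ω.weight_nonneg x y) (by
    simpa only [weight_edge] using h.upper n hn)
  have h2 := key hq (φ := fun x y => (ω.weight x y)⁻¹)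
    (fun x y _ => inv_nonneg.2 (ω.weight_nonneg x y)) (by
      refine le_trans (le_of_eq ?_) (h.lower n hn)
      refine Finset.sum_congr rfl fun e _ => ?_
      rw [weight_edge, Real.inv_rpow (ω.pos e).le, Real.rpow_neg (ω.pos e).le])
  refine (mul_le_mul h1 h2 (Finset.sum_nonneg fun x _ => ω.vertexResistance_nonneg x)
    (by positivity)).trans (le_of_eq ?_)
  have e9 : (9 : ℝ) ^ d = 3 ^ d * 3 ^ d := by rw [← mul_pow]; norm_num
  have e4 : (2 : ℝ) - (1 / p + 1 / q) = (1 - 1 / p) + (1 - 1 / q) := by ring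
  rw [e4, Real.rpow_add_of_nonneg (by positivity) (by linarith) (by linarith), e9, two_mul, pow_add]
  ring

end Conductances

/-! ### Energy and isoperimetric estimates for superlevel sets. -/

namespace Site

variable {d : ℕ}

/-- Exchanging the two endpoints of an edge requires a double sum over a symmetric index set `F ×
F`, while the equation is written with neighbour sums; this passes between the two. -/
theorem sum_eq_sum_neighbors {F : Finset (Site d)} {x : Site d} {φ : Site d → ℝ}
    (h0 : ∀ y, ¬ Adj x y → φ y = 0) (hF : ∀ y, Adj x y → y ∉ F → φ y = 0) :
    ∑ y ∈ F, φ y = ∑ y ∈ neighbors x, φ y := by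
  classical
  have h1 : ∑ y ∈ F, φ y = ∑ y ∈ F ∪ neighbors x, φ y :=
    Finset.sum_subset Finset.subset_union_left fun y _ hy => by
      by_cases h : Adj x y
      · exact hF y h hy
      · exact h0 y h
  have h2 : ∑ y ∈ neighbors x, φ y = ∑ y ∈ F ∪ neighbors x, φ y :=
    Finset.sum_subset Finset.subset_union_right fun y _ hy => h0 y fun h => hy (mem_neighbors.2 h)
  rw [h1, h2]

/-- The part of the superlevel set `{u > k}` that lies in the box `Λ_L`. -/
noncomputable def superlevel (L : ℕ) (u : Site d → ℝ) (k : ℝ) : Finset (Site d) :=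
  (box d L).filter fun x => k < u x

theorem mem_superlevel {L : ℕ} {u : Site d → ℝ} {k : ℝ} {x : Site d} :
    x ∈ superlevel L u k ↔ x ∈ box d L ∧ k < u x := Finset.mem_filter

theorem superlevel_subset_box {L : ℕ} {u : Site d → ℝ} {k : ℝ} : superlevel L u k ⊆ box d L :=
  Finset.filter_subset _ _

theorem superlevel_anti {L : ℕ} {u : Site d → ℝ} {k h : ℝ} (hkh : k ≤ h) :
    superlevel L u h ⊆ superlevel L u k := fun _ hx =>
  mem_superlevel.2 ⟨(mem_superlevel.1 hx).1, hkh.trans_lt (mem_superlevel.1 hx).2⟩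

end Site

/-- When both points are above level `k`, the increment of `a` is that of the truncation plus `a' -
b'`, and Young's inequality absorbs the cross term. When only one is, the truncated part contributes
with a favourable sign. -/
theorem gradient_truncation_le {a b a' b' k s : ℝ} (hs : |a' - b'| ≤ s) :
    (max (a - a' - k) 0 - max (b - b' - k) 0) ^ 2 / 2 -
      s ^ 2 / 2 * ((if k < a - a' then 1 else 0) + (if k < b - b' then 1 else 0)) ≤
    (a - b) * (max (a - a' - k) 0 - max (b - b' - k) 0) := by
  have h1 := abs_le.1 hs
  have hs0 : 0 ≤ s := (abs_nonneg _).trans hs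
  have h2 : (a' - b') ^ 2 ≤ s ^ 2 := sq_le_sq' h1.1 h1.2
  split_ifs with h3 h4 h4
  · rw [max_eq_left (by linarith), max_eq_left (by linarith)]
    nlinarith [sq_nonneg (a - b)]
  · rw [max_eq_left (by linarith), max_eq_right (by linarith)]
    have h5 : 0 ≤ (a - a' - k) * (-(b - b' - k)) := mul_nonneg (by linarith) (by linarith)
    nlinarith [sq_nonneg (a - a' - k + (a' - b'))]
  · rw [max_eq_right (by linarith), max_eq_left (by linarith)]
    have h5 : 0 ≤ (b - b' - k) * (-(a - a' - k)) := mul_nonneg (by linarith) (by linarith)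
    nlinarith [sq_nonneg (b - b' - k - (a' - b'))]
  · rw [max_eq_right (by linarith), max_eq_right (by linarith)]
    simp

namespace Conductances

variable {d : ℕ}

theorem sum_weight_mul (ω : Conductances d) {F : Finset (Site d)} {x : Site d}
    (hF : ∀ y, Site.Adj x y → y ∈ F) (φ : Site d → ℝ) :
    ∑ y ∈ F, ω.weight x y * φ y = ∑ y ∈ x.neighbors, ω.weight x y * φ y :=
  Site.sum_eq_sum_neighbors (fun y hy => by rw [ω.weight_eq_zero hy, zero_mul])
    fun y hy hyF => absurd (hF y hy) hyF

theorem sum_weight_eq (ω : Conductances d) {F : Finset (Site d)} {x : Site d}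
    (hF : ∀ y, Site.Adj x y → y ∈ F) : ∑ y ∈ F, ω.weight x y = ω.vertexWeight x := by
  simpa [vertexWeight] using ω.sum_weight_mul hF fun _ => 1

open Classical in
/-- The energy inequality for the truncations of `v - ψ` where `v` is a subsolution of the
equation with killing and `ψ` is Lipschitz. -/
theorem energy_truncation_le (ω : Conductances d) {L : ℕ} {v ψ : Site d → ℝ} {k κ s : ℝ}
    (hψ : ∀ x y, Site.Adj x y → |ψ x - ψ y| ≤ s)
    (hsub : ∀ x ∈ Site.box d L, k < v x - ψ x →
      (1 + κ) * (v x * ω.vertexWeight x) ≤ ∑ y ∈ x.neighbors, ω.weight x y * v y)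
    (hout : ∀ x ∉ Site.box d L, v x - ψ x ≤ k) :
    1 / 4 * ∑ x ∈ Site.box d (L + 1), ∑ y ∈ Site.box d (L + 1),
        ω.weight x y * (max (v x - ψ x - k) 0 - max (v y - ψ y - k) 0) ^ 2 +
      κ * ∑ x ∈ Site.superlevel L (fun x => v x - ψ x) k,
        ω.vertexWeight x * v x * (v x - ψ x - k) ≤
      s ^ 2 / 2 * ∑ x ∈ Site.superlevel L (fun x => v x - ψ x) k, ω.vertexWeight x := by
  set F := Site.box d (L + 1) with hF
  set A := Site.superlevel L (fun x => v x - ψ x) k with hA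
  set w : Site d → ℝ := fun x => max (v x - ψ x - k) 0 with hw
  set χ : Site d → ℝ := fun x => if k < v x - ψ x then 1 else 0 with hχ
  have hAF : A ⊆ F := fun x hx => by
    have := Site.mem_box.1 (Site.superlevel_subset_box hx)
    refine Site.mem_box.2 fun i => ?_
    push_cast
    constructor <;> linarith [(this i).1, (this i).2]
  have hnA : ∀ x ∉ A, v x - ψ x ≤ k := by
    intro x hx
    by_contra hcon
    refine hx (Site.mem_superlevel.2 ⟨?_, not_le.1 hcon⟩)
    by_contra hbox
    exact hcon (hout x hbox)
  have hw0 : ∀ x ∉ A, w x = 0 := fun x hx => max_eq_right (by linarith [hnA x hx])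
  have hχ0 : ∀ x ∉ A, χ x = 0 := fun x hx => if_neg (not_lt.2 (hnA x hx))
  have hχ1 : ∀ x ∈ A, χ x = 1 := fun x hx => if_pos (Site.mem_superlevel.1 hx).2
  have hnbr : ∀ x ∈ A, ∀ y, Site.Adj x y → y ∈ F := fun x hx y hy =>
    Site.mem_box_succ_of_adj hy (Site.superlevel_subset_box hx)
  have restrict : ∀ φ : Site d → ℝ, (∀ x ∉ A, φ x = 0) → ∑ x ∈ F, φ x = ∑ x ∈ A, φ x :=
    fun φ hφ => (Finset.sum_subset hAF fun x _ hx => hφ x hx).symm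
  have swap : ∀ φ : Site d → Site d → ℝ, ∑ x ∈ F, ∑ y ∈ F, ω.weight x y * φ x y =
      ∑ x ∈ F, ∑ y ∈ F, ω.weight x y * φ y x := by
    intro φ
    rw [Finset.sum_comm]
    exact Finset.sum_congr rfl fun x _ => Finset.sum_congr rfl fun y _ => by rw [ω.weight_comm]
  have e1 : ∑ x ∈ F, ∑ y ∈ F, ω.weight x y * χ x = ∑ x ∈ A, ω.vertexWeight x := by
    rw [restrict _ fun x hx => by simp [hχ0 x hx]]
    refine Finset.sum_congr rfl fun x hx => ?_
    rw [← ω.sum_weight_eq (hnbr x hx), hχ1 x hx]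
    simp
  have e2 : ∑ x ∈ F, ∑ y ∈ F, ω.weight x y * χ y = ∑ x ∈ A, ω.vertexWeight x := by
    rw [← e1, swap fun x _ => χ x]
  -- The subsolution inequality tested against `w`, which vanishes off `A`; `e4` is the
  -- corresponding summation by parts.
  have e3 : ∑ x ∈ F, ∑ y ∈ F, ω.weight x y * ((v x - v y) * w x) ≤
      -(κ * ∑ x ∈ A, ω.vertexWeight x * v x * (v x - ψ x - k)) := by
    rw [restrict _ fun x hx => by simp [hw0 x hx], Finset.mul_sum, ← Finset.sum_neg_distrib]
    refine Finset.sum_le_sum fun x hx => ?_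
    have hxA := Site.mem_superlevel.1 hx
    rw [ω.sum_weight_mul (hnbr x hx)]
    have h1 : ∑ y ∈ x.neighbors, ω.weight x y * ((v x - v y) * w x) =
        (v x * ω.vertexWeight x - ∑ y ∈ x.neighbors, ω.weight x y * v y) * w x := by
      rw [vertexWeight, Finset.mul_sum, ← Finset.sum_sub_distrib, Finset.sum_mul]
      exact Finset.sum_congr rfl fun y _ => by ring
    have h2 : w x = v x - ψ x - k := max_eq_left (by linarith [hxA.2])
    have h3 := hsub x hxA.1 hxA.2
    have h4 : 0 ≤ w x := le_max_right _ _
    rw [h1, ← h2]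
    nlinarith
  have e4 : ∑ x ∈ F, ∑ y ∈ F, ω.weight x y * ((v x - v y) * (w x - w y)) =
      2 * ∑ x ∈ F, ∑ y ∈ F, ω.weight x y * ((v x - v y) * w x) := by
    rw [two_mul]
    nth_rewrite 2 [swap fun x y => (v x - v y) * w x]
    simp only [← Finset.sum_add_distrib]
    exact Finset.sum_congr rfl fun x _ => Finset.sum_congr rfl fun y _ => by ring
  have e5 : ∑ x ∈ F, ∑ y ∈ F, (ω.weight x y * (w x - w y) ^ 2 / 2 -
        s ^ 2 / 2 * (ω.weight x y * χ x + ω.weight x y * χ y)) ≤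
      ∑ x ∈ F, ∑ y ∈ F, ω.weight x y * ((v x - v y) * (w x - w y)) := by
    refine Finset.sum_le_sum fun x _ => Finset.sum_le_sum fun y _ => ?_
    by_cases hxy : Site.Adj x y
    · have := mul_le_mul_of_nonneg_left
        (gradient_truncation_le (a := v x) (b := v y) (k := k) (hψ x y hxy))
        (ω.weight_nonneg x y)
      refine le_trans (le_of_eq ?_) this
      ring
    · simp [ω.weight_eq_zero hxy]
  simp only [Finset.sum_sub_distrib, ← Finset.mul_sum, ← Finset.sum_div,
    Finset.sum_add_distrib, e1, e2, e4] at e5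
  linarith

/-- A Cauchy–Schwarz bound of the `ℓ¹`-norm of a gradient by the energy. -/
theorem sq_sum_abs_sub_le (ω : Conductances d) {L : ℕ} {w : Site d → ℝ} {A : Finset (Site d)}
    (hA : A ⊆ Site.box d L) (hw : ∀ x ∉ A, w x = 0) :
    (∑ x ∈ Site.box d (L + 1), ∑ y ∈ x.neighbors, |w x - w y|) ^ 2 ≤
      (∑ x ∈ Site.box d (L + 1), ∑ y ∈ Site.box d (L + 1), ω.weight x y * (w x - w y) ^ 2) *
        (2 * ∑ x ∈ A, ω.vertexResistance x) := by
  classical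
  set F := Site.box d (L + 1) with hF
  set χ : Site d → ℝ := fun x => if x ∈ A then 1 else 0 with hχ
  have hAF : A ⊆ F := fun x hx => by
    have := Site.mem_box.1 (hA hx)
    refine Site.mem_box.2 fun i => ?_
    push_cast
    constructor <;> linarith [(this i).1, (this i).2]
  have hnbr : ∀ x ∈ A, ∀ y, Site.Adj x y → y ∈ F := fun x hx y hy =>
    Site.mem_box_succ_of_adj hy (hA hx)
  have e1 : ∑ x ∈ F, ∑ y ∈ F, (ω.weight x y)⁻¹ * χ x = ∑ x ∈ A, ω.vertexResistance x := by
    rw [← Finset.sum_subset hAF fun x _ hx => by simp [hχ, hx]]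
    refine Finset.sum_congr rfl fun x hx => ?_
    rw [Site.sum_eq_sum_neighbors (fun y hy => by simp [ω.weight_eq_zero hy])
      (fun y hy hyF => absurd (hnbr x hx y hy) hyF)]
    simp [hχ, hx, vertexResistance]
  have e2 : ∑ x ∈ F, ∑ y ∈ F, (ω.weight x y)⁻¹ * χ y = ∑ x ∈ A, ω.vertexResistance x := by
    rw [← e1, Finset.sum_comm]
    exact Finset.sum_congr rfl fun x _ => Finset.sum_congr rfl fun y _ => by rw [ω.weight_comm]
  have e3 : ∑ x ∈ F, ∑ y ∈ x.neighbors, |w x - w y| ≤ ∑ x ∈ F, ∑ y ∈ F,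
      (Real.sqrt (ω.weight x y) * |w x - w y|) *
        (Real.sqrt (ω.weight x y)⁻¹ * Real.sqrt (χ x + χ y)) := by
    refine Finset.sum_le_sum fun x _ => ?_
    rw [Site.sum_eq_sum_neighbors (x := x) (F := F)]
    · refine Finset.sum_le_sum fun y hy => ?_
      have hc := ω.weight_pos (Site.mem_neighbors.1 hy)
      -- The gradient vanishes across edges that miss `A`, so the factor `χ x + χ y ≥ 1` can be
      -- inserted for free. It confines the resistance sum to edges meeting `A`, counted once from
      -- each endpoint.
      by_cases hxy : x ∈ A ∨ y ∈ A
      · have h1 : 1 ≤ Real.sqrt (χ x + χ y) := by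
          rw [Real.one_le_sqrt]
          rcases hxy with h | h
          · have : 0 ≤ χ y := by simp only [hχ]; split_ifs <;> norm_num
            simp only [hχ, h, if_true] at this ⊢
            linarith
          · have : 0 ≤ χ x := by simp only [hχ]; split_ifs <;> norm_num
            simp only [hχ, h, if_true] at this ⊢
            linarith
        have h2 : Real.sqrt (ω.weight x y) * Real.sqrt (ω.weight x y)⁻¹ = 1 := by
          rw [← Real.sqrt_mul hc.le, mul_inv_cancel₀ hc.ne', Real.sqrt_one]
        calc |w x - w y| ≤ |w x - w y| * Real.sqrt (χ x + χ y) :=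
              le_mul_of_one_le_right (abs_nonneg _) h1
          _ = (Real.sqrt (ω.weight x y) * Real.sqrt (ω.weight x y)⁻¹) *
              (|w x - w y| * Real.sqrt (χ x + χ y)) := by rw [h2, one_mul]
          _ = _ := by ring
      · push Not at hxy
        simp [hw x hxy.1, hw y hxy.2]
    · intro y hy
      simp [ω.weight_eq_zero hy]
    · intro y hy hyF
      have hyA : y ∉ A := fun h => hyF (hAF h)
      have hxA : x ∉ A := fun h => hyF (hnbr x h y hy)
      simp [hw x hxA, hw y hyA]
  have hnn : 0 ≤ ∑ x ∈ F, ∑ y ∈ x.neighbors, |w x - w y| :=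
    Finset.sum_nonneg fun _ _ => Finset.sum_nonneg fun _ _ => abs_nonneg _
  refine (pow_le_pow_left₀ hnn e3 2).trans ?_
  simp only [← Finset.sum_product']
  refine (Finset.sum_mul_sq_le_sq_mul_sq _ _ _).trans (le_of_eq ?_)
  congr 1
  · refine Finset.sum_congr rfl fun z _ => ?_
    rw [mul_pow, Real.sq_sqrt (ω.weight_nonneg _ _), sq_abs]
  · have : ∀ z ∈ F ×ˢ F, (Real.sqrt (ω.weight z.1 z.2)⁻¹ * Real.sqrt (χ z.1 + χ z.2)) ^ 2 =
        (ω.weight z.1 z.2)⁻¹ * χ z.1 + (ω.weight z.1 z.2)⁻¹ * χ z.2 := by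
      intro z _
      rw [mul_pow, Real.sq_sqrt (inv_nonneg.2 (ω.weight_nonneg _ _)), Real.sq_sqrt]
      · ring
      · simp only [hχ]
        split_ifs <;> norm_num
    rw [Finset.sum_congr rfl this, Finset.sum_add_distrib, Finset.sum_product, Finset.sum_product,
      e1, e2, two_mul]

section Levels

variable (ω : Conductances d) {L : ℕ} {v ψ : Site d → ℝ} {κ s : ℝ}

/-- The isoperimetric estimate that compares two levels of `v - ψ`. -/
theorem level_sq_mul_card_rpow_le [NeZero d] (hd : 2 ≤ d) (hκ : 0 ≤ κ) (hψ0 : ∀ x, 0 ≤ ψ x)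
    (hψ : ∀ x y, Site.Adj x y → |ψ x - ψ y| ≤ s)
    (hsub : ∀ x ∈ Site.box d L, 0 < v x - ψ x →
      (1 + κ) * (v x * ω.vertexWeight x) ≤ ∑ y ∈ x.neighbors, ω.weight x y * v y)
    (hout : ∀ x ∉ Site.box d L, v x - ψ x ≤ 0) {k h : ℝ} (hk : 0 ≤ k) (hkh : k < h) :
    (h - k) ^ 2 * ((Site.superlevel L (fun x => v x - ψ x) h).card : ℝ) ^ (2 - 2 / (d : ℝ)) ≤
      4 * s ^ 2 * ((∑ x ∈ Site.superlevel L (fun x => v x - ψ x) k, ω.vertexWeight x) *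
        ∑ x ∈ Site.superlevel L (fun x => v x - ψ x) k, ω.vertexResistance x) := by
  set A := Site.superlevel L (fun x => v x - ψ x) k with hA
  set S := Site.superlevel L (fun x => v x - ψ x) h with hS
  set w : Site d → ℝ := fun x => max (v x - ψ x - k) 0 with hw
  have hE := ω.energy_truncation_le (k := k) hψ (fun x hx hx' => hsub x hx (hk.trans_lt hx'))
    fun x hx => (hout x hx).trans hk
  have hw0 : ∀ x ∉ A, w x = 0 := by
    intro x hx
    refine max_eq_right ?_
    by_contra hcon
    refine hx (Site.mem_superlevel.2 ⟨?_, by linarith⟩)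
    by_contra hbox
    linarith [hout x hbox]
  have hG := ω.sq_sum_abs_sub_le (Site.superlevel_subset_box (u := fun x => v x - ψ x) (k := k)) hw0
  have hI := Site.mul_card_rpow_le_sum_gradient hd (w := w) (F := Site.box d (L + 1)) (S := S)
    (t := h - k) (fun x hx => by
      have hxA : ∀ y, y ∈ A → x ≠ y ∧ ¬ Site.Adj x y := fun y hy =>
        ⟨fun hxy => hx (by
          have := Site.mem_box.1 (Site.superlevel_subset_box hy)
          rw [hxy]
          refine Site.mem_box.2 fun i => ?_
          push_cast
          constructor <;> linarith [(this i).1, (this i).2]),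
        fun hxy => hx (Site.mem_box_succ_of_adj hxy.symm (Site.superlevel_subset_box hy))⟩
      exact ⟨hw0 x fun h => (hxA x h).1 rfl,
        fun y hy => hw0 y fun h => (hxA y h).2 (Site.mem_neighbors.1 hy)⟩)
    (by linarith) (fun x hx => le_max_of_le_left (by
      have := (Site.mem_superlevel.1 hx).2
      linarith))
  -- Only the Dirichlet energy is needed here. The killing term is nonnegative, because `v > ψ ≥ 0`
  -- on `A`, and is dropped; the next lemma does the opposite.
  have hkill : 0 ≤ κ * ∑ x ∈ A, ω.vertexWeight x * v x * (v x - ψ x - k) := by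
    refine mul_nonneg hκ (Finset.sum_nonneg fun x hx => ?_)
    have := (Site.mem_superlevel.1 hx).2
    have h1 := hψ0 x
    exact mul_nonneg (mul_nonneg (ω.vertexWeight_pos x).le (by linarith)) (by linarith)
  have hR : 0 ≤ ∑ x ∈ A, ω.vertexResistance x :=
    Finset.sum_nonneg fun x _ => ω.vertexResistance_nonneg x
  have hsq : (h - k) ^ 2 * (S.card : ℝ) ^ (2 - 2 / (d : ℝ)) =
      ((h - k) * (S.card : ℝ) ^ (1 - 1 / (d : ℝ))) ^ 2 := by
    rw [mul_pow, ← Real.rpow_natCast ((S.card : ℝ) ^ _), ← Real.rpow_mul (Nat.cast_nonneg _)]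
    congr 2
    push_cast
    ring
  rw [hsq]
  refine (pow_le_pow_left₀ (mul_nonneg (by linarith) (by positivity)) hI 2).trans (hG.trans ?_)
  have hE' : ∑ x ∈ Site.box d (L + 1), ∑ y ∈ Site.box d (L + 1), ω.weight x y * (w x - w y) ^ 2 ≤
      2 * s ^ 2 * ∑ x ∈ A, ω.vertexWeight x := by linarith
  refine (mul_le_mul_of_nonneg_right hE' (mul_nonneg (by norm_num) hR)).trans (le_of_eq ?_)
  ring

/-- The bound of the size of a superlevel set of `v - ψ` by the killing rate. -/
theorem sq_mul_sq_card_superlevel_le [NeZero d] (hκ : 0 < κ) (hψ0 : ∀ x, 0 ≤ ψ x)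
    (hψ : ∀ x y, Site.Adj x y → |ψ x - ψ y| ≤ s)
    (hsub : ∀ x ∈ Site.box d L, 0 < v x - ψ x →
      (1 + κ) * (v x * ω.vertexWeight x) ≤ ∑ y ∈ x.neighbors, ω.weight x y * v y)
    (hout : ∀ x ∉ Site.box d L, v x - ψ x ≤ 0) {k : ℝ} (hk : 0 ≤ k) :
    k ^ 2 * ((Site.superlevel L (fun x => v x - ψ x) k).card : ℝ) ^ 2 ≤
      s ^ 2 / (2 * κ) * ((∑ x ∈ Site.superlevel L (fun x => v x - ψ x) 0, ω.vertexWeight x) *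
        ∑ x ∈ Site.superlevel L (fun x => v x - ψ x) 0, ω.vertexResistance x) := by
  set A := Site.superlevel L (fun x => v x - ψ x) 0 with hA
  set S := Site.superlevel L (fun x => v x - ψ x) k with hS
  have hE := ω.energy_truncation_le (k := 0) hψ hsub hout
  have hD : 0 ≤ ∑ x ∈ Site.box d (L + 1), ∑ y ∈ Site.box d (L + 1),
      ω.weight x y * (max (v x - ψ x - 0) 0 - max (v y - ψ y - 0) 0) ^ 2 :=
    Finset.sum_nonneg fun _ _ => Finset.sum_nonneg fun _ _ =>
      mul_nonneg (ω.weight_nonneg _ _) (sq_nonneg _)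
  have h1 : k * (S.card : ℝ) ≤ ∑ x ∈ A, (v x - ψ x) := by
    calc k * (S.card : ℝ) = ∑ x ∈ S, k := by rw [Finset.sum_const, nsmul_eq_mul, mul_comm]
      _ ≤ ∑ x ∈ S, (v x - ψ x) :=
        Finset.sum_le_sum fun x hx => (Site.mem_superlevel.1 hx).2.le
      _ ≤ _ := Finset.sum_le_sum_of_subset_of_nonneg (Site.superlevel_anti hk)
        fun x hx _ => (Site.mem_superlevel.1 hx).2.le
  have h2 : (∑ x ∈ A, (v x - ψ x)) ^ 2 ≤
      (∑ x ∈ A, ω.vertexWeight x * (v x - ψ x) ^ 2) * ∑ x ∈ A, ω.vertexResistance x := by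
    have h3 : ∑ x ∈ A, (v x - ψ x) = ∑ x ∈ A, (Real.sqrt (ω.vertexWeight x) * (v x - ψ x)) *
        Real.sqrt (ω.vertexWeight x)⁻¹ := by
      refine Finset.sum_congr rfl fun x _ => ?_
      have hc := ω.vertexWeight_pos x
      have h4 : Real.sqrt (ω.vertexWeight x) * Real.sqrt (ω.vertexWeight x)⁻¹ = 1 := by
        rw [← Real.sqrt_mul hc.le, mul_inv_cancel₀ hc.ne', Real.sqrt_one]
      rw [mul_right_comm, h4, one_mul]
    rw [h3]
    refine (Finset.sum_mul_sq_le_sq_mul_sq _ _ _).trans ?_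
    refine mul_le_mul (le_of_eq ?_) ?_ (Finset.sum_nonneg fun _ _ => sq_nonneg _)
      (Finset.sum_nonneg fun x _ => mul_nonneg (ω.vertexWeight_pos x).le (sq_nonneg _))
    · exact Finset.sum_congr rfl fun x _ => by rw [mul_pow, Real.sq_sqrt (ω.vertexWeight_pos x).le]
    · refine Finset.sum_le_sum fun x _ => ?_
      rw [Real.sq_sqrt (inv_nonneg.2 (ω.vertexWeight_pos x).le)]
      exact ω.inv_vertexWeight_le x
  have h5 : ∑ x ∈ A, ω.vertexWeight x * (v x - ψ x) ^ 2 ≤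
      s ^ 2 / (2 * κ) * ∑ x ∈ A, ω.vertexWeight x := by
    have h6 : ∑ x ∈ A, ω.vertexWeight x * (v x - ψ x) ^ 2 ≤
        ∑ x ∈ A, ω.vertexWeight x * v x * (v x - ψ x - 0) := by
      refine Finset.sum_le_sum fun x hx => ?_
      have h7 := (Site.mem_superlevel.1 hx).2
      -- Since `ψ ≥ 0`, the killing term dominates the weighted `ℓ²` norm of `v - ψ`.
      have h8 : (v x - ψ x) ^ 2 ≤ v x * (v x - ψ x - 0) := by nlinarith [hψ0 x]
      rw [mul_assoc]
      exact mul_le_mul_of_nonneg_left h8 (ω.vertexWeight_pos x).le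
    have h9 : κ * ∑ x ∈ A, ω.vertexWeight x * (v x - ψ x) ^ 2 ≤
        s ^ 2 / 2 * ∑ x ∈ A, ω.vertexWeight x := by
      have := mul_le_mul_of_nonneg_left h6 hκ.le
      linarith
    rw [← le_div_iff₀' hκ] at h9
    refine h9.trans (le_of_eq ?_)
    field_simp
  have hS0 : 0 ≤ k * (S.card : ℝ) := by positivity
  calc k ^ 2 * (S.card : ℝ) ^ 2 = (k * S.card) ^ 2 := by ring
    _ ≤ (∑ x ∈ A, (v x - ψ x)) ^ 2 := pow_le_pow_left₀ hS0 h1 2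
    _ ≤ _ := h2
    _ ≤ s ^ 2 / (2 * κ) * (∑ x ∈ A, ω.vertexWeight x) * ∑ x ∈ A, ω.vertexResistance x :=
      mul_le_mul_of_nonneg_right h5 (Finset.sum_nonneg fun x _ => ω.vertexResistance_nonneg x)
    _ = _ := by ring

end Levels

end Conductances

/-! ### The `ℓ¹` metric and the pointwise bound for subsolutions. -/

namespace Site

variable {d : ℕ}

/-- The `ℓ¹`-distance of two sites. -/
noncomputable def dist1 (x y : Site d) : ℝ := ∑ i, |(x i : ℝ) - y i|

theorem dist1_nonneg (x y : Site d) : 0 ≤ dist1 x y := Finset.sum_nonneg fun _ _ => abs_nonneg _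

theorem dist1_self (x : Site d) : dist1 x x = 0 := by simp [dist1]

theorem dist1_comm (x y : Site d) : dist1 x y = dist1 y x :=
  Finset.sum_congr rfl fun _ _ => abs_sub_comm _ _

theorem dist1_triangle (x y z : Site d) : dist1 x z ≤ dist1 x y + dist1 y z := by
  unfold dist1
  rw [← Finset.sum_add_distrib]
  exact Finset.sum_le_sum fun i _ => abs_sub_le _ _ _

theorem Adj.dist1_eq {x y : Site d} (h : Adj x y) : dist1 x y = 1 := by
  have h' : ∑ i, |x i - y i| = 1 := h
  unfold dist1
  exact_mod_cast h'

theorem abs_sub_le_dist1 (x y : Site d) (i : Fin d) : |(x i : ℝ) - y i| ≤ dist1 x y :=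
  Finset.single_le_sum (f := fun i => |(x i : ℝ) - y i|) (fun _ _ => abs_nonneg _)
    (Finset.mem_univ i)

theorem mem_box_of_dist1_le {x : Site d} {n : ℕ} (h : dist1 x 0 ≤ n) : x ∈ box d n := by
  refine mem_box.2 fun i => ?_
  have h1 := abs_le.1 ((abs_sub_le_dist1 x 0 i).trans h)
  simp only [Pi.zero_apply, Int.cast_zero, sub_zero] at h1
  exact ⟨by exact_mod_cast h1.1, by exact_mod_cast h1.2⟩

end Site

namespace Conductances

variable {d : ℕ}

/-- The transition operator of the random walk. -/
noncomputable def transOp (ω : Conductances d) (f : Site d → ℝ) (x : Site d) : ℝ :=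
  ∑ y ∈ x.neighbors, ω.transProb x y * f y

theorem transProb_nonneg [NeZero d] (ω : Conductances d) (x y : Site d) : 0 ≤ ω.transProb x y :=
  div_nonneg (ω.weight_nonneg _ _) (ω.vertexWeight_pos x).le

theorem sum_transProb [NeZero d] (ω : Conductances d) (x : Site d) :
    ∑ y ∈ x.neighbors, ω.transProb x y = 1 := by
  simp only [transProb, ← Finset.sum_div]
  exact div_self (ω.vertexWeight_pos x).ne'

theorem transOp_mono [NeZero d] (ω : Conductances d) {f g : Site d → ℝ} {x : Site d}
    (h : ∀ y, Site.Adj x y → f y ≤ g y) : ω.transOp f x ≤ ω.transOp g x :=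
  Finset.sum_le_sum fun y hy =>
    mul_le_mul_of_nonneg_left (h y (Site.mem_neighbors.1 hy)) (ω.transProb_nonneg x y)

theorem transOp_const_mul (ω : Conductances d) (a : ℝ) (f : Site d → ℝ) (x : Site d) :
    ω.transOp (fun y => a * f y) x = a * ω.transOp f x := by
  simp only [transOp, Finset.mul_sum]
  exact Finset.sum_congr rfl fun _ _ => by ring

theorem transOp_const [NeZero d] (ω : Conductances d) (a : ℝ) (x : Site d) :
    ω.transOp (fun _ => a) x = a := by
  simp only [transOp, ← Finset.sum_mul, ω.sum_transProb, one_mul]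

theorem transOp_mul_vertexWeight [NeZero d] (ω : Conductances d) (f : Site d → ℝ) (x : Site d) :
    ω.transOp f x * ω.vertexWeight x = ∑ y ∈ x.neighbors, ω.weight x y * f y := by
  simp only [transOp, Finset.sum_mul, transProb]
  refine Finset.sum_congr rfl fun y _ => ?_
  have := (ω.vertexWeight_pos x).ne'
  field_simp

/-- The maximum principle for subsolutions of the equation with killing rate `κ` in a ball of
radius comparable to `L`, with the bound `C (κ L²)^{-γ}` at the centre. -/
theorem exists_subsolution_le [NeZero d] (hd : 2 ≤ d) {p q : ℝ} (hp : 1 ≤ p) (hq : 1 ≤ q)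
    (hpq : 1 / p + 1 / q < 2 / (d : ℝ)) {K : ℝ} (hK : 1 ≤ K) :
    ∃ γ : ℝ, 0 < γ ∧ ∀ H : ℝ, 0 < H → ∃ C : ℝ, 1 ≤ C ∧ ∀ ω : Conductances d, ω.MomentBound p q K →
      ∀ (L : ℕ) (x₀ : Site d) (r κ : ℝ) (v : Site d → ℝ), 1 ≤ L → (L : ℝ) ≤ H * r → 0 < r → 0 < κ →
        (∀ x, Site.dist1 x x₀ < r → x ∈ Site.box d L) → (∀ x, v x ≤ 1) →
        (∀ x, Site.dist1 x x₀ < r → (1 + κ) * v x ≤ ω.transOp v x) →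
        v x₀ ≤ C * (1 / (κ * (L : ℝ) ^ 2)) ^ γ := by
  have hd' : (2 : ℝ) ≤ d := by exact_mod_cast hd
  set σ : ℝ := 1 / p + 1 / q with hσ
  set τ : ℝ := 2 / (d : ℝ) - σ with hτ
  set e : ℝ := 2 - 2 / (d : ℝ) with he
  set b : ℝ := (2 - σ) / e with hb
  have hd1 : 2 / (d : ℝ) ≤ 1 := by rw [div_le_one (by linarith)]; exact hd'
  have hσ0 : 0 < σ := by positivity
  have hτ0 : 0 < τ := by linarith
  have hτ1 : τ ≤ 1 := by linarith
  have he0 : 0 < e := by linarith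
  have hb1 : 1 < b := by rw [hb, one_lt_div he0]; linarith
  have hbe : e * b = 2 - σ := by rw [hb]; field_simp
  have hbτ : e * (b - 1) = τ := by rw [mul_sub, hbe]; linarith
  -- The factor `8` is `4 · 2`: the starting level is `δ ^ (1/4)`, and the height `D` of the
  -- iteration is of order that level to the power `τ / 2`.
  refine ⟨τ / 8, by linarith, fun H hH => ?_⟩
  set C₁ : ℝ := 4 * K ^ 2 * 9 ^ d * H ^ 2 with hC₁
  have hC₁0 : 0 < C₁ := by positivity
  set C₂ : ℝ := C₁ * 4 * 4 ^ (1 / (b - 1)) * (Real.sqrt (C₁ * 9 ^ d)) ^ τ with hC₂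
  have hC₂0 : 0 < C₂ := by
    have : 0 < Real.sqrt (C₁ * 9 ^ d) := Real.sqrt_pos.2 (by positivity)
    positivity
  refine ⟨1 + Real.sqrt C₂, by linarith [Real.sqrt_nonneg C₂], ?_⟩
  intro ω hω L x₀ r κ v hL hLr hr hκ hball hv1 hsub
  have hL0 : (0 : ℝ) < L := by exact_mod_cast hL
  set δ : ℝ := 1 / (κ * (L : ℝ) ^ 2) with hδ
  have hδ0 : 0 < δ := by positivity
  have hCC : 1 ≤ 1 + Real.sqrt C₂ := by linarith [Real.sqrt_nonneg C₂]
  rcases le_or_gt 1 δ with hδ1 | hδ1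
  · refine (hv1 x₀).trans ?_
    have := Real.one_le_rpow hδ1 (by linarith : 0 ≤ τ / 8)
    nlinarith
  -- The cone replaces a cutoff function: it is zero at `x₀`, is `1 / r`-Lipschitz along edges, and
  -- is at least `1 ≥ v` outside the ball.
  set ψ : Site d → ℝ := fun x => Site.dist1 x x₀ / r with hψ
  have hψ0 : ∀ x, 0 ≤ ψ x := fun x => div_nonneg (Site.dist1_nonneg _ _) hr.le
  have hψs : ∀ x y, Site.Adj x y → |ψ x - ψ y| ≤ 1 / r := by
    intro x y hxy
    have h1 := Site.dist1_triangle x y x₀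
    have h2 := Site.dist1_triangle y x x₀
    rw [Site.dist1_comm y x] at h2
    rw [hxy.dist1_eq] at h1 h2
    simp only [hψ]
    rw [← sub_div, abs_div, abs_of_pos hr]
    gcongr
    rw [abs_le]
    constructor <;> linarith
  have hin : ∀ x, 0 < v x - ψ x → Site.dist1 x x₀ < r := by
    intro x hx
    have h1 : ψ x < 1 := by linarith [hv1 x]
    simpa [hψ, div_lt_one hr] using h1
  have hsub' : ∀ x ∈ Site.box d L, 0 < v x - ψ x →
      (1 + κ) * (v x * ω.vertexWeight x) ≤ ∑ y ∈ x.neighbors, ω.weight x y * v y := by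
    intro x _ hx
    rw [← ω.transOp_mul_vertexWeight, ← mul_assoc]
    exact mul_le_mul_of_nonneg_right (hsub x (hin x hx)) (ω.vertexWeight_pos x).le
  have hout : ∀ x ∉ Site.box d L, v x - ψ x ≤ 0 := by
    intro x hx
    by_contra hcon
    exact hx (hball x (hin x (not_le.1 hcon)))
  set u : Site d → ℝ := fun x => v x - ψ x with hu
  set V : ℝ := (L : ℝ) ^ d with hV
  have hV0 : 0 < V := by positivity
  set a : ℝ → ℝ := fun k => ((Site.superlevel L u k).card : ℝ) / V with ha
  have ha0 : ∀ k, 0 ≤ a k := fun k => by positivity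
  have ha_anti : Antitone a := fun k h hkh => by
    simp only [ha]
    gcongr
    exact Site.superlevel_anti hkh
  have hrH : (1 / r) ^ 2 * (L : ℝ) ^ 2 ≤ H ^ 2 := by
    rw [← mul_pow, one_div, inv_mul_eq_div]
    refine pow_le_pow_left₀ (by positivity) ?_ 2
    rw [div_le_iff₀ hr]
    exact hLr
  have hprod := fun k => hω.sum_mul_sum_le hp hq hL
    (Site.superlevel_subset_box (L := L) (u := u) (k := k))
  have hV2 : (L : ℝ) ^ (2 * d) = V ^ 2 := by rw [hV, ← pow_mul, mul_comm]
  have hVe : V ^ e * (L : ℝ) ^ 2 = V ^ 2 := by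
    rw [hV, ← Real.rpow_natCast, ← Real.rpow_natCast, ← Real.rpow_natCast, ← Real.rpow_mul hL0.le,
      ← Real.rpow_mul hL0.le, ← Real.rpow_add hL0]
    congr 1
    rw [he]
    push_cast
    field_simp
    ring
  have hrec : ∀ k h, 0 ≤ k → k < h → (h - k) ^ 2 * a h ^ e ≤ C₁ * (a k ^ e) ^ b := by
    intro k h hk hkh
    have h1 := ω.level_sq_mul_card_rpow_le hd hκ.le hψ0 hψs hsub' hout hk hkh
    rw [← Real.rpow_mul (ha0 k), hbe]
    have h2 : V ^ e * ((h - k) ^ 2 * a h ^ e) ≤ V ^ e * (C₁ * a k ^ (2 - σ)) := by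
      calc V ^ e * ((h - k) ^ 2 * a h ^ e)
          = (h - k) ^ 2 * ((Site.superlevel L u h).card : ℝ) ^ e := by
            simp only [ha]
            rw [Real.div_rpow (Nat.cast_nonneg _) hV0.le]
            have : 0 < V ^ e := by positivity
            field_simp
        _ ≤ 4 * (1 / r) ^ 2 * (K ^ 2 * 9 ^ d * (L : ℝ) ^ (2 * d) * a k ^ (2 - σ)) :=
            h1.trans (mul_le_mul_of_nonneg_left (hprod k) (by positivity))
        _ = V ^ e * (4 * K ^ 2 * 9 ^ d * ((1 / r) ^ 2 * (L : ℝ) ^ 2) * a k ^ (2 - σ)) := by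
            rw [hV2, ← hVe]; ring
        _ ≤ V ^ e * (4 * K ^ 2 * 9 ^ d * H ^ 2 * a k ^ (2 - σ)) := by
            have := Real.rpow_nonneg (ha0 k) (2 - σ)
            gcongr
        _ = _ := by rw [hC₁]
    exact le_of_mul_le_mul_left h2 (by positivity)
  -- The killing estimate reads `k₀² a(k₀)² ≤ C δ`. With `δ = k₀ ^ 4` it makes the density at level
  -- `k₀` at most of order `k₀`.
  set k₀ : ℝ := δ ^ (1 / 4 : ℝ) with hk₀
  have hk₀0 : 0 < k₀ := by positivity
  have hk₀4 : k₀ ^ 4 = δ := by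
    rw [hk₀, ← Real.rpow_natCast, ← Real.rpow_mul hδ0.le]
    norm_num
  have hstart : a k₀ ≤ Real.sqrt (C₁ * 9 ^ d) * k₀ := by
    have h1 := ω.sq_mul_sq_card_superlevel_le hκ hψ0 hψs hsub' hout hk₀0.le
    have h3 : a 0 ^ (2 - σ) ≤ 9 ^ d := by
      have h4 : a 0 ≤ 3 ^ d := by
        simp only [ha]
        rw [div_le_iff₀ hV0]
        refine le_trans ?_ (Site.card_box_le hL)
        exact_mod_cast Finset.card_le_card Site.superlevel_subset_box
      have h5 : (1 : ℝ) ≤ 3 ^ d := one_le_pow₀ (by norm_num)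
      calc a 0 ^ (2 - σ) ≤ ((3 : ℝ) ^ d) ^ (2 - σ) := Real.rpow_le_rpow (ha0 0) h4 (by linarith)
        _ ≤ ((3 : ℝ) ^ d) ^ (2 : ℝ) := Real.rpow_le_rpow_of_exponent_le h5 (by linarith)
        _ = 9 ^ d := by
          rw [Real.rpow_ofNat, ← pow_mul, mul_comm, pow_mul]
          norm_num
    have h2 : V ^ 2 * (k₀ ^ 2 * a k₀ ^ 2) ≤ V ^ 2 * (k₀ ^ 2 * (C₁ * 9 ^ d * k₀ ^ 2)) := by
      calc V ^ 2 * (k₀ ^ 2 * a k₀ ^ 2) = k₀ ^ 2 * ((Site.superlevel L u k₀).card : ℝ) ^ 2 := by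
            simp only [ha]
            field_simp
        _ ≤ (1 / r) ^ 2 / (2 * κ) * (K ^ 2 * 9 ^ d * (L : ℝ) ^ (2 * d) * a 0 ^ (2 - σ)) :=
            h1.trans (mul_le_mul_of_nonneg_left (hprod 0) (by positivity))
        _ ≤ (1 / r) ^ 2 / (2 * κ) * (K ^ 2 * 9 ^ d * (L : ℝ) ^ (2 * d) * 9 ^ d) := by gcongr
        _ = V ^ 2 * (((1 / r) ^ 2 * (L : ℝ) ^ 2) * K ^ 2 * 9 ^ d * 9 ^ d * δ / 2) := by
            rw [hV2, hδ]
            field_simp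
        _ ≤ V ^ 2 * (H ^ 2 * K ^ 2 * 9 ^ d * 9 ^ d * δ / 2) := by gcongr
        _ ≤ V ^ 2 * (4 * (H ^ 2 * K ^ 2 * 9 ^ d * 9 ^ d * δ)) := by
            have : 0 ≤ H ^ 2 * K ^ 2 * 9 ^ d * 9 ^ d * δ := by positivity
            gcongr
            linarith
        _ = _ := by rw [← hk₀4, hC₁]; ring
    have h3 : a k₀ ^ 2 ≤ C₁ * 9 ^ d * k₀ ^ 2 :=
      le_of_mul_le_mul_left (le_of_mul_le_mul_left h2 (by positivity)) (by positivity)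
    refine (pow_le_pow_iff_left₀ (ha0 _) (by positivity) two_ne_zero).1 ?_
    rw [mul_pow, Real.sq_sqrt (by positivity)]
    exact h3
  -- The smallness condition of Stampacchia's lemma asks for `D²` of order `a(k₀) ^ τ`, hence of
  -- order `k₀ ^ τ`.
  set D : ℝ := Real.sqrt C₂ * k₀ ^ (τ / 2) with hD
  have hD0 : 0 < D := mul_pos (Real.sqrt_pos.2 hC₂0) (by positivity)
  have hsmall : C₁ * 4 * 4 ^ (1 / (b - 1)) * (a k₀ ^ e) ^ (b - 1) ≤ D ^ 2 := by
    rw [← Real.rpow_mul (ha0 _), hbτ, hD, mul_pow, Real.sq_sqrt hC₂0.le, hC₂]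
    have h1 : a k₀ ^ τ ≤ (Real.sqrt (C₁ * 9 ^ d)) ^ τ * k₀ ^ τ := by
      rw [← Real.mul_rpow (Real.sqrt_nonneg _) hk₀0.le]
      exact Real.rpow_le_rpow (ha0 _) hstart hτ0.le
    have h2 : (k₀ ^ (τ / 2)) ^ 2 = k₀ ^ τ := by
      rw [← Real.rpow_natCast, ← Real.rpow_mul hk₀0.le]
      congr 1
      push_cast
      ring
    rw [h2, mul_assoc _ (Real.sqrt _ ^ τ)]
    exact mul_le_mul_of_nonneg_left h1 (by positivity)
  have hzero := eq_zero_of_sq_mul_le_rpow (g := fun k => a k ^ e)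
    (fun k => Real.rpow_nonneg (ha0 k) _)
    (fun k h hkh => Real.rpow_le_rpow (ha0 h) (ha_anti hkh) he0.le) hC₁0.le hb1 hD0
    (fun k h hk hkh => hrec k h (hk₀0.le.trans hk) hkh) hsmall
  have hempty : (Site.superlevel L u (k₀ + D)).card = 0 := by
    have h1 := (Real.rpow_eq_zero (ha0 _) he0.ne').1 hzero
    simp only [ha, div_eq_zero_iff, hV0.ne', or_false] at h1
    exact_mod_cast h1
  have hx₀ : v x₀ ≤ k₀ + D := by
    by_contra hcon
    have h1 : x₀ ∈ Site.superlevel L u (k₀ + D) := by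
      refine Site.mem_superlevel.2 ⟨hball x₀ (by rwa [Site.dist1_self]), ?_⟩
      simp only [hu, hψ, Site.dist1_self, zero_div, sub_zero]
      exact not_le.1 hcon
    rw [Finset.card_eq_zero.1 hempty] at h1
    simp at h1
  refine hx₀.trans ?_
  have hD' : k₀ ^ (τ / 2) = δ ^ (τ / 8) := by
    rw [hk₀, ← Real.rpow_mul hδ0.le]
    congr 1
    ring
  have hk₀' : k₀ ≤ δ ^ (τ / 8) :=
    Real.rpow_le_rpow_of_exponent_ge hδ0 hδ1.le (by linarith)
  rw [hD, hD', add_mul, one_mul]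
  linarith

end Conductances

/-! ### Nested balls and exit probabilities. -/

namespace Conductances

variable {d : ℕ}

/-- Iteration of `exists_subsolution_le` along `m` nested balls. -/
theorem exists_subsolution_le_pow [NeZero d] (hd : 2 ≤ d) {p q : ℝ} (hp : 1 ≤ p) (hq : 1 ≤ q)
    (hpq : 1 / p + 1 / q < 2 / (d : ℝ)) {K : ℝ} (hK : 1 ≤ K) :
    ∃ γ : ℝ, 0 < γ ∧ ∀ H : ℝ, 0 < H → ∃ C : ℝ, 1 ≤ C ∧ ∀ ω : Conductances d, ω.MomentBound p q K →
      ∀ (L : ℕ) (x₀ : Site d) (r κ : ℝ) (v : Site d → ℝ) (m : ℕ), 1 ≤ L → (L : ℝ) ≤ H * r →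
        0 < r → 0 < κ → (∀ x, Site.dist1 x x₀ < m * (r + 1) → x ∈ Site.box d L) → (∀ x, v x ≤ 1) →
        (∀ x, Site.dist1 x x₀ < m * (r + 1) → (1 + κ) * v x ≤ ω.transOp v x) →
        v x₀ ≤ (C * (1 / (κ * (L : ℝ) ^ 2)) ^ γ) ^ m := by
  obtain ⟨γ, hγ, h⟩ := exists_subsolution_le hd hp hq hpq hK
  refine ⟨γ, hγ, fun H hH => ?_⟩
  obtain ⟨C, hC, h⟩ := h H hH
  refine ⟨C, hC, fun ω hω L x₀ r κ v m hL hLr hr hκ hball hv1 hsub => ?_⟩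
  have hL0 : (0 : ℝ) < L := by exact_mod_cast hL
  set θ : ℝ := C * (1 / (κ * (L : ℝ) ^ 2)) ^ γ with hθ
  have hθ0 : 0 < θ := by positivity
  have key : ∀ j ≤ m, ∀ x, Site.dist1 x x₀ ≤ (m - j : ℝ) * (r + 1) → v x ≤ θ ^ j := by
    intro j
    induction j with
    | zero => intro _ x _; simpa using hv1 x
    | succ j ih =>
      intro hj x hx
      have hjm : (j : ℝ) + 1 ≤ m := by exact_mod_cast hj
      push_cast at hx
      have hθj : 0 < θ ^ j := by positivity
      have hnear : ∀ y, Site.dist1 y x < r + 1 → v y ≤ θ ^ j := by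
        intro y hy
        refine ih (by omega) y ?_
        have := Site.dist1_triangle y x x₀
        nlinarith
      have hin : ∀ y, Site.dist1 y x < r → Site.dist1 y x₀ < m * (r + 1) := by
        intro y hy
        have h1 := Site.dist1_triangle y x x₀
        have h2 : 0 ≤ (j : ℝ) * (r + 1) := by positivity
        nlinarith
      -- Capping at `θ ^ j` and rescaling restores the global bound by `1`. The cap is inactive
      -- within distance `r + 1` of `x`, hence also at the neighbours of points within distance `r`,
      -- which is why each layer has width `r + 1`.
      have hmain := h ω hω L x r κ (fun y => (θ ^ j)⁻¹ * min (v y) (θ ^ j)) hL hLr hr hκ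
        (fun y hy => hball y (hin y hy))
        (fun y => by
          rw [inv_mul_le_iff₀ hθj, mul_one]
          exact min_le_right _ _)
        (fun y hy => by
          rw [transOp_const_mul, min_eq_left (hnear y (by linarith)), mul_left_comm]
          refine mul_le_mul_of_nonneg_left ((hsub y (hin y hy)).trans ?_) (by positivity)
          refine ω.transOp_mono fun z hz => ?_
          rw [min_eq_left (hnear z _)]
          have := Site.dist1_triangle z y x
          rw [Site.dist1_comm z y, hz.dist1_eq] at this
          linarith)
      rw [min_eq_left (hnear x (by rw [Site.dist1_self]; linarith)), inv_mul_le_iff₀ hθj] at hmain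
      rwa [pow_succ]
  refine key m le_rfl x₀ ?_
  rw [Site.dist1_self]
  simp

open Classical in
/-- The probability that the walk started at `x` leaves `B` within `k` steps. -/
noncomputable def exitProb (ω : Conductances d) (B : Set (Site d)) : ℕ → Site d → ℝ
  | 0, x => if x ∈ B then 0 else 1
  | k + 1, x => if x ∈ B then ω.transOp (exitProb ω B k) x else 1

theorem exitProb_of_notMem (ω : Conductances d) {B : Set (Site d)} (k : ℕ) {x : Site d}
    (hx : x ∉ B) : ω.exitProb B k x = 1 := by
  cases k <;> simp [exitProb, hx]

theorem exitProb_zero_of_mem (ω : Conductances d) {B : Set (Site d)} {x : Site d}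
    (hx : x ∈ B) : ω.exitProb B 0 x = 0 := by simp [exitProb, hx]

theorem exitProb_succ_of_mem (ω : Conductances d) {B : Set (Site d)} (k : ℕ) {x : Site d}
    (hx : x ∈ B) : ω.exitProb B (k + 1) x = ω.transOp (ω.exitProb B k) x := by simp [exitProb, hx]

theorem exitProb_nonneg [NeZero d] (ω : Conductances d) (B : Set (Site d)) (k : ℕ) (x : Site d) :
    0 ≤ ω.exitProb B k x := by
  induction k generalizing x with
  | zero => unfold exitProb; split_ifs <;> norm_num
  | succ k ih =>
    unfold exitProb
    split_ifs
    · exact Finset.sum_nonneg fun y _ => mul_nonneg (ω.transProb_nonneg _ _) (ih y)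
    · norm_num

theorem exitProb_le_one [NeZero d] (ω : Conductances d) (B : Set (Site d)) (k : ℕ) (x : Site d) :
    ω.exitProb B k x ≤ 1 := by
  induction k generalizing x with
  | zero => unfold exitProb; split_ifs <;> norm_num
  | succ k ih =>
    unfold exitProb
    split_ifs
    · exact (ω.transOp_mono fun y _ => ih y).trans_eq (ω.transOp_const 1 x)
    · exact le_rfl

/-- Quenched bound for the probability of a quick exit from a ball. -/
theorem exists_exitProb_le [NeZero d] (hd : 2 ≤ d) {p q : ℝ} (hp : 1 ≤ p) (hq : 1 ≤ q)
    (hpq : 1 / p + 1 / q < 2 / (d : ℝ)) {K : ℝ} (hK : 1 ≤ K) :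
    ∃ γ : ℝ, 0 < γ ∧ ∀ H : ℝ, 0 < H → ∃ C : ℝ, 1 ≤ C ∧ ∀ ω : Conductances d, ω.MomentBound p q K →
      ∀ (L : ℕ) (x₀ : Site d) (r : ℝ) (m k : ℕ), 1 ≤ L → (L : ℝ) ≤ H * r → 0 < r → 1 ≤ k →
        (∀ x, Site.dist1 x x₀ < m * (r + 1) → x ∈ Site.box d L) →
        ω.exitProb {x | Site.dist1 x x₀ < m * (r + 1)} k x₀ ≤
          3 * (C * ((k : ℝ) / (L : ℝ) ^ 2) ^ γ) ^ m := by
  obtain ⟨γ, hγ, h⟩ := exists_subsolution_le_pow hd hp hq hpq hK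
  refine ⟨γ, hγ, fun H hH => ?_⟩
  obtain ⟨C, hC, h⟩ := h H hH
  refine ⟨C, hC, fun ω hω L x₀ r m k hL hLr hr hk hball => ?_⟩
  have hk0 : (0 : ℝ) < k := by exact_mod_cast hk
  set B : Set (Site d) := {x | Site.dist1 x x₀ < m * (r + 1)} with hB
  set κ : ℝ := 1 / k with hκ
  have hκ0 : 0 < κ := by positivity
  set l : ℝ := (1 + κ)⁻¹ with hl
  have hl0 : 0 < l := by positivity
  have hl1 : l ≤ 1 := inv_le_one_of_one_le₀ (by linarith)
  have hne : (Finset.range (k + 1)).Nonempty := ⟨0, by simp⟩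
  -- One step of the walk shifts the horizon by one, at the cost of one factor `l`. Maximizing over
  -- all horizons `j ≤ k` absorbs the shift. Undoing the discount later costs only `(1 + 1/k) ^ k ≤
  -- 3`.
  set v : Site d → ℝ := fun x =>
    (Finset.range (k + 1)).sup' hne fun j => l ^ j * ω.exitProb B j x with hv
  have hle : ∀ j ≤ k, ∀ x, l ^ j * ω.exitProb B j x ≤ v x := fun j hj x =>
    Finset.le_sup' (fun j => l ^ j * ω.exitProb B j x) (Finset.mem_range.2 (by omega))
  have hv0 : ∀ x, 0 ≤ v x := fun x => by
    refine le_trans ?_ (hle 0 (Nat.zero_le _) x)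
    simpa using ω.exitProb_nonneg B 0 x
  have hv1 : ∀ x, v x ≤ 1 := fun x => Finset.sup'_le _ _ fun j _ =>
    mul_le_one₀ (pow_le_one₀ hl0.le hl1) (ω.exitProb_nonneg B j x) (ω.exitProb_le_one B j x)
  have hsub : ∀ x, x ∈ B → (1 + κ) * v x ≤ ω.transOp v x := by
    intro x hx
    rw [← le_inv_mul_iff₀ (by positivity), ← hl]
    refine Finset.sup'_le _ _ fun j hj => ?_
    cases j with
    | zero =>
      rw [ω.exitProb_zero_of_mem hx, mul_zero]
      exact mul_nonneg hl0.le (Finset.sum_nonneg fun y _ =>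
        mul_nonneg (ω.transProb_nonneg _ _) (hv0 y))
    | succ j =>
      rw [ω.exitProb_succ_of_mem j hx, pow_succ', mul_assoc, ← transOp_const_mul]
      refine mul_le_mul_of_nonneg_left (ω.transOp_mono fun y _ => hle j ?_ y) hl0.le
      have := Finset.mem_range.1 hj
      omega
  have h1 := h ω hω L x₀ r κ v m hL hLr hr hκ0 hball hv1 hsub
  have h2 := hle k le_rfl x₀
  have h3 : (1 + κ) ^ k ≤ 3 := by
    calc (1 + κ) ^ k ≤ Real.exp κ ^ k := by
          refine pow_le_pow_left₀ (by positivity) ?_ k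
          linarith [Real.add_one_le_exp κ]
      _ = Real.exp 1 := by
          rw [← Real.exp_nat_mul, hκ, mul_one_div_cancel hk0.ne']
      _ ≤ 3 := by linarith [Real.exp_one_lt_d9]
  have h4 : 1 / (κ * (L : ℝ) ^ 2) = (k : ℝ) / (L : ℝ) ^ 2 := by
    rw [hκ]
    field_simp
  rw [h4] at h1
  calc ω.exitProb B k x₀ = (1 + κ) ^ k * (l ^ k * ω.exitProb B k x₀) := by
        rw [← mul_assoc, ← mul_pow, hl, mul_inv_cancel₀ (by positivity), one_pow, one_mul]
    _ ≤ 3 * v x₀ := mul_le_mul h3 h2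
        (mul_nonneg (by positivity) (ω.exitProb_nonneg B k x₀)) (by norm_num)
    _ ≤ _ := by linarith

/-! ### The Markov property of the trajectory law. -/

section Law

variable [NeZero d] (ω : Conductances d)

theorem lintegral_stepMeasure (f : Site d → ℝ) (hf : ∀ x, 0 ≤ f x) (x : Site d) :
    ∫⁻ y, ENNReal.ofReal (f y) ∂(ω.stepMeasure x) = ENNReal.ofReal (ω.transOp f x) := by
  unfold stepMeasure transOp
  rw [lintegral_finsetSum_measure, ENNReal.ofReal_sum_of_nonneg
    fun y _ => mul_nonneg (ω.transProb_nonneg _ _) (hf y)]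
  refine Finset.sum_congr rfl fun y _ => ?_
  rw [lintegral_smul_measure, lintegral_dirac, ENNReal.ofReal_mul (ω.transProb_nonneg _ _),
    smul_eq_mul]

/-- The one-step Markov property. -/
theorem setLIntegral_walkLaw_succ (x₀ : Site d) (s : ℕ) {A : Set ((_ : Finset.Iic s) → Site d)}
    (hA : MeasurableSet A) (f : Site d → ℝ≥0∞) :
    ∫⁻ X in (Preorder.frestrictLe s ⁻¹' A), f (X (s + 1)) ∂(ω.walkLaw x₀) =
      ∫⁻ X in (Preorder.frestrictLe s ⁻¹' A), ∫⁻ y, f y ∂(ω.stepMeasure (X s)) ∂(ω.walkLaw x₀) := by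
  have hmap := Kernel.map_frestrictLe_trajMeasure_compProd_eq_map_trajMeasure
    (X := fun _ => Site d) (μ₀ := Measure.dirac x₀) (κ := ω.historyKernel) (a := s)
  have hf : Measurable fun z : ((_ : Finset.Iic s) → Site d) × Site d => f z.2 :=
    (measurable_of_countable f).comp measurable_snd
  have hr : Measurable (Preorder.frestrictLe (π := fun _ => Site d) s) := by fun_prop
  have h1 : ∫⁻ X in (Preorder.frestrictLe s ⁻¹' A), f (X (s + 1)) ∂(ω.walkLaw x₀) =
      ∫⁻ z in A ×ˢ Set.univ, f z.2 ∂((ω.walkLaw x₀).map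
        (fun x => (Preorder.frestrictLe s x, x (s + 1)))) := by
    rw [setLIntegral_map (hA.prod MeasurableSet.univ) hf (by fun_prop)]
    congr 2
    ext X
    simp
  rw [h1]
  unfold walkLaw
  rw [← hmap, Measure.setLIntegral_compProd hf hA MeasurableSet.univ]
  rw [setLIntegral_map hA _ hr]
  · refine lintegral_congr fun X => ?_
    rw [Measure.restrict_univ]
    rfl
  · exact Measurable.setLIntegral_kernel_prod_right hf MeasurableSet.univ

/-- The Markov property for the exit from `B` after time `s`. -/
theorem measure_inter_exists_notMem (x₀ : Site d) (B : Set (Site d)) (k s : ℕ)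
    {A : Set ((_ : Finset.Iic s) → Site d)} (hA : MeasurableSet A) :
    ω.walkLaw x₀ (Preorder.frestrictLe s ⁻¹' A ∩ {X | ∃ j ≤ k, X (s + j) ∉ B}) =
      ∫⁻ X in (Preorder.frestrictLe s ⁻¹' A), ENNReal.ofReal (ω.exitProb B k (X s))
        ∂(ω.walkLaw x₀) := by
  classical
  have hr : ∀ s, Measurable (Preorder.frestrictLe (π := fun _ : ℕ => Site d) s) :=
    fun s => by fun_prop
  induction k generalizing s with
  | zero =>
    have h0 : ∀ x, ENNReal.ofReal (ω.exitProb B 0 x) = Bᶜ.indicator 1 x := by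
      intro x
      by_cases hx : x ∈ B
      · simp [ω.exitProb_zero_of_mem hx, hx]
      · simp [ω.exitProb_of_notMem 0 hx, hx]
    have hm : MeasurableSet ((fun X : ℕ → Site d => X s) ⁻¹' Bᶜ) :=
      (measurable_pi_apply s) MeasurableSet.of_discrete
    simp only [h0]
    have : ∀ X : ℕ → Site d, Bᶜ.indicator (1 : Site d → ℝ≥0∞) (X s) =
        ((fun X : ℕ → Site d => X s) ⁻¹' Bᶜ).indicator 1 X := fun X => rfl
    simp only [this]
    rw [lintegral_indicator_one hm, Measure.restrict_apply hm, Set.inter_comm]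
    congr 1
    ext X
    simp
  | succ k ih =>
    -- On `X s ∈ B` the exit happens after time `s`. The event is re-read as one about the history
    -- up to `s + 1`, so that the induction hypothesis applies there; on `X s ∉ B` both sides are
    -- the measure of the event.
    set A₁ : Set ((_ : Finset.Iic s) → Site d) :=
      A ∩ {h | h ⟨s, Finset.mem_Iic.2 le_rfl⟩ ∈ B} with hA₁
    have hevB : MeasurableSet {h : (_ : Finset.Iic s) → Site d |
        h ⟨s, Finset.mem_Iic.2 le_rfl⟩ ∈ B} :=
      (measurable_pi_apply (⟨s, Finset.mem_Iic.2 le_rfl⟩ : Finset.Iic s)) MeasurableSet.of_discrete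
    have hA₁m : MeasurableSet A₁ := hA.inter hevB
    set A₂ : Set ((_ : Finset.Iic (s + 1)) → Site d) :=
      Preorder.frestrictLe₂ (π := fun _ : ℕ => Site d) (Nat.le_succ s) ⁻¹' A₁ with hA₂
    have hA₂m : MeasurableSet A₂ := by
      have : Measurable (Preorder.frestrictLe₂ (π := fun _ : ℕ => Site d) (Nat.le_succ s)) := by
        fun_prop
      exact this hA₁m
    have hpre : Preorder.frestrictLe (π := fun _ : ℕ => Site d) (s + 1) ⁻¹' A₂ =
        Preorder.frestrictLe s ⁻¹' A₁ := rfl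
    set E : Set (ℕ → Site d) := Preorder.frestrictLe s ⁻¹' A with hE
    set S : Set (ℕ → Site d) := {X | X s ∈ B} with hS
    have hSm : MeasurableSet S := (measurable_pi_apply s) MeasurableSet.of_discrete
    have hES : Preorder.frestrictLe s ⁻¹' A₁ = E ∩ S := rfl
    have hin := ih (s + 1) hA₂m
    rw [hpre, setLIntegral_walkLaw_succ ω x₀ s hA₁m
      (fun x => ENNReal.ofReal (ω.exitProb B k x)), hES] at hin
    rw [← lintegral_inter_add_sdiff _ E hSm,
      ← measure_inter_add_sdiff (E ∩ {X | ∃ j ≤ k + 1, X (s + j) ∉ B}) hSm]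
    congr 1
    · have e1 : E ∩ {X | ∃ j ≤ k + 1, X (s + j) ∉ B} ∩ S =
          E ∩ S ∩ {X | ∃ j ≤ k, X (s + 1 + j) ∉ B} := by
        ext X
        constructor
        · rintro ⟨⟨h1, j, hj, hjB⟩, h2⟩
          refine ⟨⟨h1, h2⟩, ?_⟩
          cases j with
          | zero => exact absurd h2 hjB
          | succ j => exact ⟨j, by omega, by rwa [add_assoc, add_comm 1 j]⟩
        · rintro ⟨⟨h1, h2⟩, j, hj, hjB⟩
          exact ⟨⟨h1, j + 1, by omega, by rwa [add_comm j 1, ← add_assoc]⟩, h2⟩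
      rw [e1, hin]
      refine setLIntegral_congr_fun ((hr s hA).inter hSm) fun X hX => ?_
      rw [ω.lintegral_stepMeasure _ (ω.exitProb_nonneg B k), ω.exitProb_succ_of_mem k hX.2]
    · have e2 : (E ∩ {X | ∃ j ≤ k + 1, X (s + j) ∉ B}) \ S = E \ S := by
        ext X
        constructor
        · rintro ⟨⟨h1, -⟩, h2⟩
          exact ⟨h1, h2⟩
        · rintro ⟨h1, h2⟩
          exact ⟨⟨h1, 0, by omega, h2⟩, h2⟩
      rw [e2]
      have : ∫⁻ X in E \ S, ENNReal.ofReal (ω.exitProb B (k + 1) (X s)) ∂(ω.walkLaw x₀) =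
          ∫⁻ X in E \ S, 1 ∂(ω.walkLaw x₀) :=
        setLIntegral_congr_fun ((hr s hA).diff hSm) fun X hX => by
          simp [ω.exitProb_of_notMem (k + 1) hX.2]
      rw [this, setLIntegral_one]

theorem measure_eq_inter_exists_notMem_le (x₀ x : Site d) (B : Set (Site d)) (k s : ℕ) :
    ω.walkLaw x₀ {X | X s = x ∧ ∃ j ≤ k, X (s + j) ∉ B} ≤
      ENNReal.ofReal (ω.exitProb B k x) * ω.walkLaw x₀ {X | X s = x} := by
  have hA : MeasurableSet {h : (_ : Finset.Iic s) → Site d |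
      h ⟨s, Finset.mem_Iic.2 le_rfl⟩ = x} :=
    (measurable_pi_apply (X := fun _ : Finset.Iic s => Site d) ⟨s, Finset.mem_Iic.2 le_rfl⟩)
      (measurableSet_singleton x)
  have h := ω.measure_inter_exists_notMem x₀ B k s hA
  have hm : MeasurableSet {X : ℕ → Site d | X s = x} :=
    (measurable_pi_apply (X := fun _ : ℕ => Site d) s) (measurableSet_singleton x)
  refine (le_of_eq h).trans (le_of_eq ?_)
  have : ∫⁻ X in {X : ℕ → Site d | X s = x}, ENNReal.ofReal (ω.exitProb B k (X s))
      ∂(ω.walkLaw x₀) = ∫⁻ X in {X : ℕ → Site d | X s = x}, ENNReal.ofReal (ω.exitProb B k x)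
      ∂(ω.walkLaw x₀) := setLIntegral_congr_fun hm fun X hX => by
        have : X s = x := hX
        simp only [this]
  exact this.trans (setLIntegral_const _ _)

theorem walkLaw_eval_zero (x₀ : Site d) : ω.walkLaw x₀ {X | X 0 ≠ x₀} = 0 := by
  have h : (ω.walkLaw x₀).map (Preorder.frestrictLe 0) =
      (Measure.dirac x₀).map (MeasurableEquiv.piUnique fun _ : Finset.Iic 0 => Site d).symm := by
    unfold walkLaw Kernel.trajMeasure
    rw [Measure.map_comp _ _ (by fun_prop), Kernel.traj_map_frestrictLe, Kernel.partialTraj_self,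
      Measure.id_comp]
  have hA : MeasurableSet {h : (_ : Finset.Iic 0) → Site d |
      h ⟨0, Finset.mem_Iic.2 le_rfl⟩ ≠ x₀} :=
    (measurable_pi_apply (X := fun _ : Finset.Iic 0 => Site d) ⟨0, Finset.mem_Iic.2 le_rfl⟩)
      (measurableSet_singleton x₀).compl
  have h2 : ω.walkLaw x₀ {X | X 0 ≠ x₀} = (ω.walkLaw x₀).map (Preorder.frestrictLe 0)
      {h : (_ : Finset.Iic 0) → Site d | h ⟨0, Finset.mem_Iic.2 le_rfl⟩ ≠ x₀} := by
    rw [Measure.map_apply (by fun_prop) hA]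
    rfl
  rw [h2, h, Measure.map_apply (MeasurableEquiv.measurable _) hA, Measure.dirac_apply]
  simp

end Law

end Conductances

/-! ### Confinement and modulus of continuity of the walk. -/

namespace Conductances

variable {d : ℕ} [NeZero d]

/-- The events `X s = x` are disjoint, so splitting over them loses no factor `S.card`. The set to
be left may depend on the position at time `s`. -/
theorem measure_mem_inter_exists_notMem_le (ω : Conductances d) (x₀ : Site d) (S : Finset (Site d))
    (B : Site d → Set (Site d)) (k s : ℕ) {c : ℝ} (hc : ∀ x ∈ S, ω.exitProb (B x) k x ≤ c) :
    ω.walkLaw x₀ {X | X s ∈ S ∧ ∃ j ≤ k, X (s + j) ∉ B (X s)} ≤ ENNReal.ofReal c := by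
  have hsub : {X : ℕ → Site d | X s ∈ S ∧ ∃ j ≤ k, X (s + j) ∉ B (X s)} ⊆
      ⋃ x ∈ S, {X | X s = x ∧ ∃ j ≤ k, X (s + j) ∉ B x} := by
    rintro X ⟨h1, h2⟩
    exact Set.mem_biUnion (x := X s) h1 ⟨rfl, h2⟩
  calc ω.walkLaw x₀ {X | X s ∈ S ∧ ∃ j ≤ k, X (s + j) ∉ B (X s)}
      ≤ ∑ x ∈ S, ω.walkLaw x₀ {X | X s = x ∧ ∃ j ≤ k, X (s + j) ∉ B x} :=
        (measure_mono hsub).trans (measure_biUnion_finset_le _ _)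
    _ ≤ ∑ x ∈ S, ENNReal.ofReal c * ω.walkLaw x₀ ((fun X => X s) ⁻¹' {x}) :=
        Finset.sum_le_sum fun x hx =>
          (ω.measure_eq_inter_exists_notMem_le x₀ x (B x) k s).trans
            (mul_le_mul_left (ENNReal.ofReal_le_ofReal (hc x hx)) _)
    _ ≤ ENNReal.ofReal c * 1 := by
        rw [← Finset.mul_sum, sum_measure_preimage_singleton S fun x _ =>
          (measurable_pi_apply (X := fun _ : ℕ => Site d) s) (measurableSet_singleton x)]
        exact mul_le_mul_right prob_le_one _
    _ = ENNReal.ofReal c := mul_one _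

theorem sqrt_le_natSqrt_succ (n : ℕ) : Real.sqrt n ≤ (Nat.sqrt n + 1 : ℕ) := by
  rw [Real.sqrt_le_left (Nat.cast_nonneg _)]
  exact_mod_cast (Nat.lt_succ_sqrt' n).le

theorem natSqrt_succ_le {n : ℕ} (hn : 1 ≤ n) : ((Nat.sqrt n + 1 : ℕ) : ℝ) ≤ 2 * Real.sqrt n := by
  have h1 : (Nat.sqrt n : ℝ) ≤ Real.sqrt n := Real.nat_sqrt_le_real_sqrt
  have h2 : (1 : ℝ) ≤ Real.sqrt n := Real.one_le_sqrt.2 (by exact_mod_cast hn)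
  push_cast
  linarith

/-- Up to time `T n` the walk stays with high probability in a ball of radius `O(√n)`. -/
theorem exists_confinement (hd : 2 ≤ d) {p q : ℝ} (hp : 1 ≤ p) (hq : 1 ≤ q)
    (hpq : 1 / p + 1 / q < 2 / (d : ℝ)) {K : ℝ} {ω : Conductances d} (hω : ω.MomentBound p q K)
    {T : ℕ} (hT : 1 ≤ T) {η : ℝ} (hη : 0 < η) :
    ∃ R : ℕ, 2 ≤ R ∧ ∀ n : ℕ, 1 ≤ n →
      ω.walkLaw 0 {X | ∃ j ≤ T * n, ¬ Site.dist1 (X j) 0 < (R * (Nat.sqrt n + 1) : ℕ)} ≤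
        ENNReal.ofReal η := by
  obtain ⟨γ, hγ, h⟩ := exists_exitProb_le hd hp hq hpq hω.one_le
  obtain ⟨C, hC, h⟩ := h 2 (by norm_num)
  have hlim : Filter.Tendsto (fun R : ℕ => 3 * (C * ((T : ℝ) / (R : ℝ) ^ 2) ^ γ)) Filter.atTop
      (nhds 0) := by
    have h1 : Filter.Tendsto (fun R : ℕ => (T : ℝ) / (R : ℝ) ^ 2) Filter.atTop (nhds 0) :=
      tendsto_const_nhds.div_atTop
        ((Filter.tendsto_pow_atTop two_ne_zero).comp tendsto_natCast_atTop_atTop)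
    have h2 := h1.rpow_const (p := γ) (Or.inr hγ.le)
    rw [Real.zero_rpow hγ.ne'] at h2
    simpa using (h2.const_mul C).const_mul 3
  obtain ⟨R, hR, hR2⟩ := ((hlim.eventually (gt_mem_nhds hη)).and
    (Filter.eventually_ge_atTop 2)).exists
  refine ⟨R, hR2, fun n hn => ?_⟩
  set L : ℕ := R * (Nat.sqrt n + 1) with hL
  have hRL : 2 ≤ L := le_trans hR2 (Nat.le_mul_of_pos_right R (Nat.succ_pos _))
  have hRL' : (2 : ℝ) ≤ L := by exact_mod_cast hRL
  have hbox : ∀ x : Site d, Site.dist1 x 0 < (1 : ℕ) * (((L : ℝ) - 1) + 1) → x ∈ Site.box d L := by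
    intro x hx
    refine Site.mem_box_of_dist1_le ?_
    simp only [Nat.cast_one, one_mul, sub_add_cancel] at hx
    exact hx.le
  -- A single ball suffices: the radius is `L = (L - 1) + 1`, and `L ≤ 2 (L - 1)` because `L ≥ 2`.
  have hmain := h ω hω L 0 (L - 1) 1 (T * n) (by omega) (by linarith) (by linarith)
    (Nat.mul_pos hT hn) hbox
  simp only [Nat.cast_one, one_mul, sub_add_cancel, pow_one] at hmain
  have hle : (((T * n : ℕ) : ℝ) / (L : ℝ) ^ 2) ≤ (T : ℝ) / (R : ℝ) ^ 2 := by
    have h1 : (n : ℝ) ≤ ((Nat.sqrt n + 1 : ℕ) : ℝ) ^ 2 := by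
      exact_mod_cast (Nat.lt_succ_sqrt' n).le
    have hR0 : (0 : ℝ) < R := by exact_mod_cast (by omega : 0 < R)
    rw [hL, div_le_div_iff₀ (by positivity) (by positivity)]
    push_cast at h1 ⊢
    have h2 : 0 ≤ (T : ℝ) * (R : ℝ) ^ 2 := by positivity
    nlinarith
  have hbound : ω.exitProb {x | Site.dist1 x 0 < L} (T * n) 0 ≤ η := by
    refine hmain.trans (le_trans ?_ hR.le)
    gcongr
  have hfin := ω.measure_mem_inter_exists_notMem_le 0 {0}
    (fun x => {y | Site.dist1 y x < L}) (T * n) 0 (c := η) (by simpa using hbound)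
  refine le_trans (measure_mono_ae ?_) hfin
  have h0 : ∀ᵐ X ∂(ω.walkLaw 0), X 0 = 0 := ω.walkLaw_eval_zero 0
  filter_upwards [h0] with X hX
  rintro ⟨j, hj, hjL⟩
  refine ⟨by simpa using hX, j, hj, ?_⟩
  simpa [hX] using hjL

/-- The modulus of continuity of the walk on the diffusive scale. -/
theorem exists_modulus_bound (hd : 2 ≤ d) {p q : ℝ} (hp : 1 ≤ p) (hq : 1 ≤ q)
    (hpq : 1 / p + 1 / q < 2 / (d : ℝ)) {K : ℝ} {ω : Conductances d} (hω : ω.MomentBound p q K)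
    (T : ℕ) {ε : ℝ} (hε : 0 < ε) {η : ℝ} (hη : 0 < η) :
    ∃ D n₀ : ℕ, 1 ≤ D ∧ ∀ n : ℕ, n₀ ≤ n →
      ω.walkLaw 0 {X | ∃ a b : ℕ, a ≤ b ∧ b ≤ T * n ∧ (b - a) * D ≤ n ∧
        ε * Real.sqrt n < Site.dist1 (X a) (X b)} ≤ ENNReal.ofReal η := by
  obtain ⟨R, hR, hconf⟩ := exists_confinement hd hp hq hpq hω (T := 2 * T + 2) (by omega)
    (half_pos hη)
  obtain ⟨γ, hγ, h⟩ := exists_exitProb_le hd hp hq hpq hω.one_le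
  set ε₁ : ℝ := min (ε / 3) 1 with hε₁
  have hε₁0 : 0 < ε₁ := lt_min (by positivity) one_pos
  have hε₁1 : ε₁ ≤ 1 := min_le_right _ _
  have hε₁ε : 3 * ε₁ ≤ ε := by linarith [min_le_left (ε / 3) 1]
  obtain ⟨m, hm⟩ := exists_nat_ge (2 / γ)
  have hm0 : (0 : ℝ) < m := lt_of_lt_of_le (by positivity) hm
  have hγm : 2 ≤ γ * m := by rwa [div_le_iff₀' hγ] at hm
  have hR0 : (2 : ℝ) ≤ R := by exact_mod_cast hR
  -- The order of choices matters: `C` depends on `R`, `m` and `ε₁`, and `D` is chosen only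
  -- afterwards. The value is the ratio bound for `L ≤ 4 R √n` against `r = e / m - 1 ≥ e / (2 m)`.
  obtain ⟨C, hC, h⟩ := h (8 * R * m / ε₁) (by positivity)
  obtain ⟨D, hD⟩ := exists_nat_ge (max 2 (12 * C ^ m * (T + 2) / (η / 2)))
  have hD2 : (2 : ℝ) ≤ D := (le_max_left _ _).trans hD
  have hD2' : 2 ≤ D := by exact_mod_cast hD2
  have hDη : 12 * C ^ m * (T + 2) ≤ η / 2 * D :=
    (div_le_iff₀' (half_pos hη)).1 ((le_max_right _ _).trans hD)
  -- Large `n` gives `e ≥ 2 m`, so each of the `m` layers has width `e / m ≥ 2` and the lattice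
  -- correction `-1` costs at most half of it.
  obtain ⟨n₁, hn₁⟩ := exists_nat_ge ((2 * m / ε₁) ^ 2)
  refine ⟨D, max D n₁, by omega, fun n hn => ?_⟩
  have hDn : D ≤ n := (le_max_left _ _).trans hn
  have hn1 : 1 ≤ n := by omega
  have hn0 : (0 : ℝ) < n := by exact_mod_cast hn1
  set e : ℝ := ε₁ * Real.sqrt n with he
  have hsq : 2 * m / ε₁ ≤ Real.sqrt n :=
    Real.le_sqrt_of_sq_le (hn₁.trans (by exact_mod_cast (le_max_right _ _).trans hn))
  have he2m : 2 * m ≤ e := by rwa [div_le_iff₀' hε₁0] at hsq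
  set M : ℕ := Nat.sqrt n + 1 with hM
  have hM1 : Real.sqrt n ≤ M := sqrt_le_natSqrt_succ n
  have hM2 : (M : ℝ) ≤ 2 * Real.sqrt n := natSqrt_succ_le hn1
  have hM0 : (1 : ℝ) ≤ M := by exact_mod_cast (by omega : 1 ≤ M)
  -- Rounding up makes every time gap allowed by `D` at most one block long, while `D ≤ n` still
  -- gives `k D ≤ 2 n`.
  set k : ℕ := n / D + 1 with hk
  have hkD : n < D * k := Nat.lt_mul_div_succ n (by omega)
  have hkD2 : k * D ≤ 2 * n := by
    have := Nat.div_mul_le_self n D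
    rw [hk, add_mul]
    omega
  set L : ℕ := 2 * (R * M) with hL
  have hLr : (L : ℝ) = 2 * (R * M) := by rw [hL]; push_cast; ring
  have hRM : Real.sqrt n ≤ R * M := by nlinarith
  set S : Finset (Site d) := (Site.box d (R * M)).filter fun x => Site.dist1 x 0 < (R * M : ℕ)
    with hS
  have hexit : ∀ x ∈ S, ω.exitProb {y | Site.dist1 y x < e} k x ≤ 12 * C ^ m / D ^ 2 := by
    intro x hx
    have hx' := (Finset.mem_filter.1 hx).2
    push_cast at hx'
    have hre : (m : ℝ) * ((e / m - 1) + 1) = e := by field_simp; ring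
    have hem : 2 ≤ e / m := by rwa [le_div_iff₀ hm0]
    have h1 := h ω hω L x (e / m - 1) m k (by
        have : 1 ≤ R * M := Nat.mul_pos (by omega) (by omega)
        omega) (by
        have h2 : (L : ℝ) ≤ 4 * R * Real.sqrt n := by rw [hLr]; nlinarith
        have h3 : e / m ≤ 2 * (e / m - 1) := by linarith
        calc (L : ℝ) ≤ 4 * R * Real.sqrt n := h2
          _ = 4 * R * m / ε₁ * (e / m) := by rw [he]; field_simp
          _ ≤ 4 * R * m / ε₁ * (2 * (e / m - 1)) := by gcongr
          _ = _ := by ring) (by linarith) (Nat.succ_pos _) (by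
        intro y hy
        rw [hre] at hy
        refine Site.mem_box_of_dist1_le ?_
        have h2 := Site.dist1_triangle y x 0
        have h3 : e ≤ Real.sqrt n := mul_le_of_le_one_left (Real.sqrt_nonneg _) hε₁1
        rw [hLr]
        linarith)
    rw [hre] at h1
    refine h1.trans ?_
    have hkL : (k : ℝ) / (L : ℝ) ^ 2 ≤ 2 / D := by
      have h2 : (n : ℝ) ≤ (L : ℝ) ^ 2 := by
        rw [← Real.sq_sqrt hn0.le]
        exact pow_le_pow_left₀ (Real.sqrt_nonneg _) (by rw [hLr]; linarith [Real.sqrt_nonneg n]) 2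
      have h3 : (k : ℝ) * D ≤ 2 * n := by exact_mod_cast hkD2
      rw [div_le_div_iff₀ (hn0.trans_le h2) (by linarith)]
      linarith
    have hx0 : 0 ≤ (k : ℝ) / (L : ℝ) ^ 2 := by positivity
    have hx1 : (k : ℝ) / (L : ℝ) ^ 2 ≤ 1 :=
      hkL.trans (by rw [div_le_one (by linarith)]; exact hD2)
    have h4 : (((k : ℝ) / (L : ℝ) ^ 2) ^ γ) ^ m ≤ (2 / D) ^ 2 := by
      rw [← Real.rpow_natCast, ← Real.rpow_mul hx0]
      rcases hx0.eq_or_lt with h5 | h5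
      · rw [← h5, Real.zero_rpow (by positivity)]
        positivity
      · calc ((k : ℝ) / (L : ℝ) ^ 2) ^ (γ * m) ≤ ((k : ℝ) / (L : ℝ) ^ 2) ^ (2 : ℝ) :=
              Real.rpow_le_rpow_of_exponent_ge h5 hx1 hγm
          _ = ((k : ℝ) / (L : ℝ) ^ 2) ^ 2 := Real.rpow_two _
          _ ≤ _ := pow_le_pow_left₀ hx0 hkL 2
    rw [mul_pow]
    calc 3 * (C ^ m * (((k : ℝ) / (L : ℝ) ^ 2) ^ γ) ^ m) ≤ 3 * (C ^ m * (2 / D) ^ 2) := by gcongr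
      _ = _ := by ring
  set block : ℕ → Set (ℕ → Site d) := fun i =>
    {X | X (i * k) ∈ S ∧ ∃ j ≤ k, X (i * k + j) ∉ {y | Site.dist1 y (X (i * k)) < e}} with hblock
  have hblock_le : ∀ i, ω.walkLaw 0 (block i) ≤ ENNReal.ofReal (12 * C ^ m / D ^ 2) := fun i =>
    ω.measure_mem_inter_exists_notMem_le 0 S (fun x => {y | Site.dist1 y x < e}) k (i * k) hexit
  have hincl : {X : ℕ → Site d | ∃ a b : ℕ, a ≤ b ∧ b ≤ T * n ∧ (b - a) * D ≤ n ∧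
        ε * Real.sqrt n < Site.dist1 (X a) (X b)} ⊆
      {X | ∃ j ≤ (2 * T + 2) * n, ¬ Site.dist1 (X j) 0 < (R * M : ℕ)} ∪
        ⋃ i ∈ Finset.range (T * D + 2), block i := by
    rintro X ⟨a, b, hab, hbT, hbaD, hdist⟩
    by_contra hcon
    rw [Set.mem_union, not_or] at hcon
    obtain ⟨hc1, hc2⟩ := hcon
    simp only [Set.mem_ofPred_eq, not_exists, not_and, not_not] at hc1
    simp only [Set.mem_iUnion, not_exists, Finset.mem_range] at hc2
    have hstep : ∀ i, i ≤ T * D + 1 → ∀ j ≤ k, Site.dist1 (X (i * k + j)) (X (i * k)) < e := by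
      intro i hi j hj
      by_contra hlt
      refine hc2 i (by omega) ⟨?_, j, hj, hlt⟩
      -- All block starting times fall within the confinement horizon; this is where `2 * T + 2`
      -- comes from.
      have h1 : i * k ≤ (2 * T + 2) * n := by
        have e1 : i * k ≤ (T * D + 1) * k := Nat.mul_le_mul_right k hi
        have e2 : T * (k * D) ≤ T * (2 * n) := Nat.mul_le_mul_left T hkD2
        have e3 : k * 1 ≤ k * D := Nat.mul_le_mul_left k (by omega)
        have e4 : (T * D + 1) * k = T * (k * D) + k := by ring
        have e5 : (2 * T + 2) * n = T * (2 * n) + 2 * n := by ring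
        omega
      have h2 := hc1 _ h1
      exact Finset.mem_filter.2 ⟨Site.mem_box_of_dist1_le h2.le, h2⟩
    have hk0 : 0 < k := Nat.succ_pos _
    set i := a / k with hi
    have hak : i * k + a % k = a := Nat.div_add_mod' a k
    have hmod : a % k < k := Nat.mod_lt _ hk0
    have hiTD : i ≤ T * D := by
      rw [hi]
      refine Nat.div_le_of_le_mul ?_
      have : T * n ≤ T * (D * k) := Nat.mul_le_mul_left T hkD.le
      calc a ≤ T * n := hab.trans hbT
        _ ≤ T * (D * k) := this
        _ = k * (T * D) := by ring
    have hbak : b - a ≤ k := by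
      by_contra hlt
      have : k * D ≤ (b - a) * D := Nat.mul_le_mul_right D (by omega)
      rw [mul_comm k D] at this
      omega
    have hXa := hstep i (by omega) (a % k) hmod.le
    rw [hak] at hXa
    have h3e : 3 * e ≤ ε * Real.sqrt n := by
      rw [he, ← mul_assoc]
      exact mul_le_mul_of_nonneg_right hε₁ε (Real.sqrt_nonneg _)
    have he0 : 0 ≤ e := by positivity
    have hi1 : (i + 1) * k = i * k + k := by ring
    -- The times `a` and `b` lie in the same block or in adjacent ones, so at most three excursions
    -- of size `e` are chained.
    rcases le_or_gt b ((i + 1) * k) with hb | hb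
    · obtain ⟨j', hj'⟩ : ∃ j', b = i * k + j' := ⟨b - i * k, by omega⟩
      have hXb := hstep i (by omega) j' (by omega)
      rw [← hj'] at hXb
      have h1 := Site.dist1_triangle (X a) (X (i * k)) (X b)
      rw [Site.dist1_comm (X (i * k)) (X b)] at h1
      linarith
    · obtain ⟨j', hj'⟩ : ∃ j', b = (i + 1) * k + j' := ⟨b - (i + 1) * k, by omega⟩
      have hXb := hstep (i + 1) (by omega) j' (by omega)
      rw [← hj'] at hXb
      have hXk := hstep i (by omega) k le_rfl
      rw [← hi1] at hXk
      have h1 := Site.dist1_triangle (X a) (X (i * k)) (X b)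
      have h2 := Site.dist1_triangle (X (i * k)) (X ((i + 1) * k)) (X b)
      rw [Site.dist1_comm (X (i * k)) (X ((i + 1) * k)),
        Site.dist1_comm (X ((i + 1) * k)) (X b)] at h2
      linarith
  refine (measure_mono hincl).trans ((measure_union_le _ _).trans ?_)
  have hsum : ω.walkLaw 0 (⋃ i ∈ Finset.range (T * D + 2), block i) ≤ ENNReal.ofReal (η / 2) := by
    refine (measure_biUnion_finset_le _ _).trans
      ((Finset.sum_le_sum fun i _ => hblock_le i).trans ?_)
    rw [Finset.sum_const, Finset.card_range, nsmul_eq_mul, ← ENNReal.ofReal_natCast,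
      ← ENNReal.ofReal_mul (Nat.cast_nonneg _)]
    refine ENNReal.ofReal_le_ofReal ?_
    have hCm : 0 < C ^ m := by positivity
    have h1 : ((T * D + 2 : ℕ) : ℝ) ≤ (T + 2) * D := by push_cast; nlinarith
    calc ((T * D + 2 : ℕ) : ℝ) * (12 * C ^ m / D ^ 2) ≤ (T + 2) * D * (12 * C ^ m / D ^ 2) := by
          gcongr
      _ = 12 * C ^ m * (T + 2) / D := by field_simp
      _ ≤ η / 2 := by rwa [div_le_iff₀ (by linarith)]
  calc _ ≤ ENNReal.ofReal (η / 2) + ENNReal.ofReal (η / 2) := add_le_add (hconf n hn1) hsum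
    _ = ENNReal.ofReal η := by
      rw [← ENNReal.ofReal_add (by linarith) (by linarith), add_halves]

end Conductances

/-! ### A tightness criterion on path space. -/

namespace PathSpace

variable {d : ℕ}

/-- The paths whose modulus of continuity on `[0, T]` at scale `1 / (m + 1)` exceeds `ε`. -/
def oscillating (d T m : ℕ) (ε : ℝ) : Set (PathSpace d) :=
  {f | ∃ s t : ℝ≥0, s ≤ t ∧ t ≤ T ∧ t ≤ s + 1 / (m + 1) ∧ ε < dist (f s) (f t)}

theorem isOpen_oscillating (d T m : ℕ) (ε : ℝ) : IsOpen (oscillating d T m ε) := by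
  have : oscillating d T m ε = ⋃ (s : ℝ≥0) (t : ℝ≥0) (_ : s ≤ t ∧ t ≤ T ∧ t ≤ s + 1 / (m + 1)),
      {f : PathSpace d | ε < dist (f s) (f t)} := by
    ext f
    simp [oscillating, and_assoc]
  rw [this]
  refine isOpen_iUnion fun s => isOpen_iUnion fun t => isOpen_iUnion fun _ => ?_
  exact isOpen_lt continuous_const
    ((continuous_eval_const s).dist (continuous_eval_const t))

theorem oscillating_anti {T m m' : ℕ} {ε : ℝ} (h : m ≤ m') :
    oscillating d T m' ε ⊆ oscillating d T m ε := by
  rintro f ⟨s, t, h1, h2, h3, h4⟩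
  refine ⟨s, t, h1, h2, h3.trans ?_, h4⟩
  gcongr

theorem iInter_oscillating (T : ℕ) {ε : ℝ} (hε : 0 < ε) : ⋂ m, oscillating d T m ε = ∅ := by
  rw [Set.eq_empty_iff_forall_notMem]
  intro f hf
  have huc : UniformContinuousOn f (Set.Icc 0 (T : ℝ≥0)) :=
    isCompact_Icc.uniformContinuousOn_of_continuous f.continuous.continuousOn
  obtain ⟨δ, hδ, h⟩ := Metric.uniformContinuousOn_iff.1 huc ε hε
  obtain ⟨m, hm⟩ := exists_nat_one_div_lt hδ
  obtain ⟨s, t, h1, h2, h3, h4⟩ := Set.mem_iInter.1 hf m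
  refine lt_asymm h4 (h s ⟨zero_le, h1.trans h2⟩ t ⟨zero_le, h2⟩ ?_)
  rw [dist_comm, NNReal.dist_eq, abs_of_nonneg (sub_nonneg.2 (by exact_mod_cast h1))]
  have h5 : (t : ℝ) ≤ s + 1 / (m + 1) := by exact_mod_cast h3
  linarith

/-- For one fixed law this is continuity from above: each path is uniformly continuous on `[0, T]`,
so the decreasing events have empty intersection. -/
theorem exists_measure_oscillating_le (μ : Measure (PathSpace d)) [IsFiniteMeasure μ] (T : ℕ)
    {ε : ℝ} (hε : 0 < ε) {η : ℝ≥0∞} (hη : 0 < η) : ∃ m, μ (oscillating d T m ε) ≤ η := by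
  have h := tendsto_measure_iInter_atTop (μ := μ) (s := fun m => oscillating d T m ε)
    (fun m => (isOpen_oscillating d T m ε).measurableSet.nullMeasurableSet)
    (fun m m' h => oscillating_anti h) ⟨0, measure_ne_top _ _⟩
  rw [iInter_oscillating T hε, measure_empty] at h
  exact ((h.eventually (gt_mem_nhds hη)).exists).imp fun m hm => hm.le

/-- The functions that start at `0` with prescribed moduli of continuity: on `[0, j]`, the
increments over times at most `1 / (m j + 1)` are at most `1 / (j + 1)`. -/
def HasModuli (m : ℕ → ℕ) (g : ℝ≥0 → Fin d → ℝ) : Prop :=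
  g 0 = 0 ∧ ∀ (j : ℕ) (s t : ℝ≥0), s ≤ t → t ≤ j → t ≤ s + 1 / (m j + 1) →
    dist (g s) (g t) ≤ 1 / ((j : ℝ) + 1)

/-- Walk back from `t` to `0` in steps of length at most `1 / (m j + 1)`, each of which changes the
value by at most `1`. -/
theorem HasModuli.norm_le {m : ℕ → ℕ} {g : ℝ≥0 → Fin d → ℝ} (hg : HasModuli m g) {j : ℕ} (i : ℕ)
    {t : ℝ≥0} (htj : t ≤ j) (hti : t ≤ i * (1 / (m j + 1))) : ‖g t‖ ≤ i := by
  induction i generalizing t with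
  | zero =>
    have : t = 0 := by simpa using hti
    simp [this, hg.1]
  | succ i ih =>
    have h1 : t - 1 / (m j + 1) ≤ i * (1 / (m j + 1)) := by
      rw [tsub_le_iff_right]
      refine hti.trans (le_of_eq ?_)
      push_cast
      ring
    have h2 := ih (tsub_le_self.trans htj) h1
    have h3 := hg.2 j _ t (tsub_le_self (a := t) (b := 1 / (m j + 1))) htj le_tsub_add
    have h4 : 1 / ((j : ℝ) + 1) ≤ 1 := by
      rw [div_le_one (by positivity)]
      linarith [Nat.cast_nonneg (α := ℝ) j]
    rw [dist_comm, dist_eq_norm] at h3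
    have h5 := norm_sub_norm_le (g t) (g (t - 1 / (m j + 1)))
    push_cast
    linarith

theorem HasModuli.exists_norm_le (m : ℕ → ℕ) (t : ℝ≥0) :
    ∃ R : ℝ, ∀ g : ℝ≥0 → Fin d → ℝ, HasModuli m g → ‖g t‖ ≤ R := by
  obtain ⟨j, hj⟩ := exists_nat_ge t
  obtain ⟨i, hi⟩ := exists_nat_ge (t * (m j + 1))
  refine ⟨i, fun g hg => hg.norm_le i hj ?_⟩
  rwa [mul_one_div, le_div_iff₀ (by positivity)]

/-- The radius `δ` does not depend on `g`. This gives equicontinuity, and also continuity of every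
function with these moduli. -/
theorem HasModuli.exists_dist_lt (m : ℕ → ℕ) (t₀ : ℝ≥0) {ε : ℝ} (hε : 0 < ε) :
    ∃ δ > 0, ∀ t, dist t t₀ < δ → ∀ g : ℝ≥0 → Fin d → ℝ, HasModuli m g →
      dist (g t₀) (g t) < ε := by
  obtain ⟨j₁, hj₁⟩ := exists_nat_one_div_lt hε
  obtain ⟨j₂, hj₂⟩ := exists_nat_ge (t₀ + 1)
  set j := max j₁ j₂ with hj
  have hjε : 1 / ((j : ℝ) + 1) < ε := lt_of_le_of_lt (by gcongr; exact le_max_left _ _) hj₁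
  have hjt : t₀ + 1 ≤ j := hj₂.trans (by exact_mod_cast le_max_right j₁ j₂)
  refine ⟨1 / (m j + 1), by positivity, fun t ht g hg => ?_⟩
  have hm1 : (1 : ℝ) / (m j + 1) ≤ 1 := by
    rw [div_le_one (by positivity)]
    linarith [Nat.cast_nonneg (α := ℝ) (m j)]
  rw [NNReal.dist_eq, abs_lt] at ht
  have h1 : t ≤ t₀ + 1 / (m j + 1) := by
    rw [← NNReal.coe_le_coe]
    push_cast
    linarith
  have h2 : t₀ ≤ t + 1 / (m j + 1) := by
    rw [← NNReal.coe_le_coe]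
    push_cast
    linarith
  have h3 : t ≤ j := by
    refine le_trans ?_ hjt
    rw [← NNReal.coe_le_coe]
    push_cast
    linarith
  refine lt_of_le_of_lt ?_ hjε
  rcases le_total t₀ t with h | h
  · exact hg.2 j _ _ h h3 h1
  · rw [dist_comm]
    exact hg.2 j _ _ h (le_self_add.trans hjt) h2

/-- In the topology of pointwise convergence the conditions are closed and the values are bounded at
each time, so Tychonoff applies. -/
theorem HasModuli.isCompact_setOf (m : ℕ → ℕ) :
    IsCompact {g : ℝ≥0 → Fin d → ℝ | HasModuli m g} := by
  choose R hR using HasModuli.exists_norm_le (d := d) m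
  refine IsCompact.of_isClosed_subset
    (isCompact_univ_pi fun t => isCompact_closedBall (0 : Fin d → ℝ) (R t)) ?_ fun g hg t _ => by
      simpa using hR t g hg
  have h0 : IsClosed {g : ℝ≥0 → Fin d → ℝ | g 0 = 0} :=
    isClosed_eq (continuous_apply 0) continuous_const
  have h1 : IsClosed {g : ℝ≥0 → Fin d → ℝ | ∀ (j : ℕ) (s t : ℝ≥0), s ≤ t → t ≤ j →
      t ≤ s + 1 / (m j + 1) → dist (g s) (g t) ≤ 1 / ((j : ℝ) + 1)} := by
    simp only [Set.ofPred_forall]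
    refine isClosed_iInter fun j => isClosed_iInter fun s => isClosed_iInter fun t =>
      isClosed_iInter fun _ => isClosed_iInter fun _ => isClosed_iInter fun _ => ?_
    exact isClosed_le ((continuous_apply s).dist (continuous_apply t)) continuous_const
  exact h0.inter h1

theorem HasModuli.isCompact_paths (m : ℕ → ℕ) : IsCompact {f : PathSpace d | HasModuli m f} := by
  refine ArzelaAscoli.isCompact_of_equicontinuous _ ?_ fun t₀ => ?_
  · convert HasModuli.isCompact_setOf (d := d) m using 1
    ext g
    constructor
    · rintro ⟨f, hf, rfl⟩
      exact hf
    · intro hg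
      refine ⟨⟨g, Metric.continuous_iff.2 fun t₀ ε hε => ?_⟩, hg, rfl⟩
      obtain ⟨δ, hδ, h⟩ := HasModuli.exists_dist_lt (d := d) m t₀ hε
      exact ⟨δ, hδ, fun t ht => by rw [dist_comm]; exact h t ht g hg⟩
  · rw [Metric.equicontinuousAt_iff]
    intro ε hε
    obtain ⟨δ, hδ, h⟩ := HasModuli.exists_dist_lt (d := d) m t₀ hε
    exact ⟨δ, hδ, fun t ht f => h t ht f f.2⟩

/-- A tightness criterion for sequences of laws on the path space. -/
theorem isTightMeasureSet_of_oscillating (μ : ℕ → Measure (PathSpace d))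
    [∀ n, IsFiniteMeasure (μ n)] (h0 : ∀ n, 1 ≤ n → μ n {f | f 0 ≠ 0} = 0)
    (h : ∀ (T : ℕ) (ε : ℝ), 0 < ε → ∀ η : ℝ, 0 < η →
      ∃ m n₀ : ℕ, ∀ n, n₀ ≤ n → μ n (oscillating d T m ε) ≤ ENNReal.ofReal η) :
    IsTightMeasureSet {ν : Measure (PathSpace d) | ∃ n : ℕ, 1 ≤ n ∧ ν = μ n} := by
  have hall : ∀ (T : ℕ) (ε : ℝ), 0 < ε → ∀ η : ℝ, 0 < η →
      ∃ m : ℕ, ∀ n, μ n (oscillating d T m ε) ≤ ENNReal.ofReal η := by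
    intro T ε hε η hη
    obtain ⟨m, n₀, hm⟩ := h T ε hε η hη
    -- The hypothesis concerns large `n` only; the finitely many remaining laws are treated one by
    -- one.
    choose m' hm' using fun n =>
      exists_measure_oscillating_le (μ n) T hε (ENNReal.ofReal_pos.2 hη)
    refine ⟨max m ((Finset.range n₀).sup m'), fun n => ?_⟩
    rcases le_or_gt n₀ n with hn | hn
    · exact (measure_mono (oscillating_anti (le_max_left _ _))).trans (hm n hn)
    · exact (measure_mono (oscillating_anti
        ((Finset.le_sup (Finset.mem_range.2 hn)).trans (le_max_right _ _)))).trans (hm' n)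
  rw [isTightMeasureSet_iff_exists_isCompact_measure_compl_le]
  intro ε hε
  obtain ⟨δ, hδ, hδε⟩ := ENNReal.exists_pos_sum_of_countable hε.ne' ℕ
  choose m hm using fun j : ℕ => hall j (1 / ((j : ℝ) + 1)) (by positivity) (δ j) (hδ j)
  refine ⟨_, HasModuli.isCompact_paths (d := d) m, ?_⟩
  rintro _ ⟨n, hn, rfl⟩
  have hsub : {f : PathSpace d | HasModuli m f}ᶜ ⊆
      {f | f 0 ≠ 0} ∪ ⋃ j : ℕ, oscillating d j (m j) (1 / ((j : ℝ) + 1)) := by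
    intro f hf
    by_contra hcon
    rw [Set.mem_union, not_or, Set.mem_iUnion, not_exists] at hcon
    refine hf ⟨not_not.1 hcon.1, fun j s t hst htj hts => ?_⟩
    by_contra hlt
    exact hcon.2 j ⟨s, t, hst, htj, hts, not_le.1 hlt⟩
  calc μ n {f : PathSpace d | HasModuli m f}ᶜ
      ≤ μ n {f | f 0 ≠ 0} + μ n (⋃ j : ℕ, oscillating d j (m j) (1 / ((j : ℝ) + 1))) :=
        (measure_mono hsub).trans (measure_union_le _ _)
    _ ≤ 0 + ∑' j : ℕ, μ n (oscillating d j (m j) (1 / ((j : ℝ) + 1))) :=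
        add_le_add (h0 n hn).le (measure_iUnion_le _)
    _ ≤ ∑' j : ℕ, (δ j : ℝ≥0∞) := by
        rw [zero_add]
        refine ENNReal.tsum_le_tsum fun j => (hm j n).trans_eq ?_
        rw [ENNReal.ofReal_coe_nnreal]
    _ ≤ ε := hδε.le

end PathSpace

/-! ### From the walk to the rescaled path, and conclusion. -/

theorem Site.dist_toReal_le {d : ℕ} (x y : Site d) : dist x.toReal y.toReal ≤ Site.dist1 x y :=
  (dist_pi_le_iff (Site.dist1_nonneg x y)).2 fun i => by
    rw [Real.dist_eq]
    exact Site.abs_sub_le_dist1 x y i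

theorem dist_interpolate_le {d : ℕ} (X : ℕ → Site d) (s : ℝ≥0) :
    dist (interpolate X s) (X ⌊s⌋₊).toReal ≤ Site.dist1 (X ⌊s⌋₊) (X (⌊s⌋₊ + 1)) := by
  have h1 : (⌊s⌋₊ : ℝ) ≤ s := by exact_mod_cast Nat.floor_le (zero_le (a := s))
  have h2 : (s : ℝ) < ⌊s⌋₊ + 1 := by exact_mod_cast Nat.lt_floor_add_one s
  rw [interpolate, dist_eq_norm, add_sub_cancel_left, norm_smul, Real.norm_eq_abs,
    abs_of_nonneg (by linarith), ← dist_eq_norm, dist_comm]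
  exact (mul_le_of_le_one_left dist_nonneg (by linarith)).trans (Site.dist_toReal_le _ _)

/-- An oscillation of the rescaled path forces an oscillation of the walk. -/
theorem exists_lt_dist1_of_oscillating {d T D n : ℕ} (hD : 1 ≤ D) (hn : 2 * D ≤ n) {ε : ℝ}
    {X : ℕ → Site d} (h : rescaledPath n X ∈ PathSpace.oscillating d T (2 * D) ε) :
    ∃ a b : ℕ, a ≤ b ∧ b ≤ (T + 1) * n ∧ (b - a) * D ≤ n ∧
      ε / 3 * Real.sqrt n < Site.dist1 (X a) (X b) := by
  obtain ⟨s, t, hst, htT, hts, hlt⟩ := h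
  by_contra! hcon
  have hn1 : 1 ≤ n := by omega
  have hsn : 0 < Real.sqrt n := Real.sqrt_pos.2 (by exact_mod_cast hn1)
  have hab : ⌊s * n⌋₊ ≤ ⌊t * n⌋₊ := Nat.floor_le_floor (mul_le_mul_left hst _)
  have hbT : ⌊t * n⌋₊ ≤ T * n := by
    have h1 : t * n ≤ ((T * n : ℕ) : ℝ≥0) := by
      push_cast
      exact mul_le_mul_left htT _
    exact (Nat.floor_le_floor h1).trans_eq (Nat.floor_natCast _)
  have hTn : (T + 1) * n = T * n + n := by ring
  -- Taking integer parts can lengthen the gap by one. The scale `1 / (2 D + 1)` uses half of the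
  -- budget `n / D`, and `n ≥ 2 D` lets the other half pay for that unit.
  have hbaD : (⌊t * n⌋₊ - ⌊s * n⌋₊) * D ≤ n := by
    have h1 : (⌊t * n⌋₊ : ℝ) ≤ t * n := by exact_mod_cast Nat.floor_le (zero_le (a := t * n))
    have h2 : (s * n : ℝ) < ⌊s * n⌋₊ + 1 := by exact_mod_cast Nat.lt_floor_add_one (s * n)
    have h3 : (t : ℝ) ≤ s + 1 / ((2 * D : ℕ) + 1) := by exact_mod_cast hts
    have hD0 : (0 : ℝ) < D := by exact_mod_cast hD
    have h4 : (t - s : ℝ) * (2 * D) ≤ 1 := by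
      have h5 : (t - s : ℝ) ≤ 1 / (2 * D) := by
        refine (sub_le_iff_le_add'.2 h3).trans ?_
        push_cast
        gcongr
        linarith
      rwa [le_div_iff₀ (by positivity)] at h5
    have hnD : (2 * D : ℝ) ≤ n := by exact_mod_cast hn
    have h6 : ((⌊t * n⌋₊ : ℝ) - ⌊s * n⌋₊) * D ≤ n := by
      have h7 : ((⌊t * n⌋₊ : ℝ) - ⌊s * n⌋₊) ≤ (t - s) * n + 1 := by linarith
      have h8 := mul_le_mul_of_nonneg_right h7 hD0.le
      have h9 := mul_le_mul_of_nonneg_right h4 (Nat.cast_nonneg (α := ℝ) n)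
      nlinarith
    rw [← Nat.cast_le (α := ℝ), Nat.cast_mul, Nat.cast_sub hab]
    exact h6
  -- The interpolation error is a single increment of the walk, bounded by the same modulus. Its
  -- right endpoint may pass `T n`, hence the horizon `T + 1`; the two errors and the main increment
  -- account for `ε / 3`.
  have hstep : ∀ r : ℝ≥0, r ≤ t →
      dist (interpolate X (r * n)) (X ⌊r * n⌋₊).toReal ≤ ε / 3 * Real.sqrt n := by
    intro r hr
    have h1 : ⌊r * n⌋₊ ≤ ⌊t * n⌋₊ := Nat.floor_le_floor (mul_le_mul_left hr _)
    refine (dist_interpolate_le X _).trans (hcon _ _ (Nat.le_succ _) (by omega) ?_)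
    rw [Nat.add_sub_cancel_left]
    omega
  have hmid := (Site.dist_toReal_le _ _).trans (hcon _ _ hab (by omega) hbaD)
  have htri : dist (interpolate X (s * n)) (interpolate X (t * n)) ≤ ε * Real.sqrt n := by
    have h1 := dist_triangle (interpolate X (s * n)) (X ⌊s * n⌋₊).toReal (interpolate X (t * n))
    have h2 := dist_triangle (X ⌊s * n⌋₊).toReal (X ⌊t * n⌋₊).toReal (interpolate X (t * n))
    rw [dist_comm (X ⌊t * n⌋₊).toReal] at h2
    linarith [hstep s hst, hstep t le_rfl]
  refine absurd hlt (not_lt.2 ?_)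
  change dist ((1 / Real.sqrt n) • interpolate X (s * n)) ((1 / Real.sqrt n) •
    interpolate X (t * n)) ≤ ε
  rw [dist_smul₀, Real.norm_eq_abs, abs_of_pos (by positivity), one_div, inv_mul_le_iff₀ hsn,
    mul_comm (Real.sqrt n)]
  exact htri

theorem mainTheorem9 (d : ℕ) [NeZero d] (hd : 2 ≤ d) (p q : ℝ)
    (hp : (d : ℝ) / 2 < p) (hq : (d : ℝ) / 2 < q) (hpq : 1 / p + 1 / q < 2 / (d : ℝ))
    (ω : Conductances d) (hω : ω ∈ Conductances.momentClass d p q) :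
    IsTightMeasureSet {μ : Measure (PathSpace d) | ∃ n : ℕ, 1 ≤ n ∧ μ = ω.pathLaw n} := by
  have hd' : (2 : ℝ) ≤ d := by exact_mod_cast hd
  obtain ⟨K, hK⟩ := Conductances.exists_momentBound hω
  refine PathSpace.isTightMeasureSet_of_oscillating ω.pathLaw (fun n _ => ?_)
    fun T ε hε η hη => ?_
  · have hm : MeasurableSet {f : PathSpace d | f 0 ≠ 0} :=
      (isOpen_ne_fun (continuous_eval_const 0) continuous_const).measurableSet
    rw [Conductances.pathLaw, Measure.map_apply (measurable_rescaledPath n) hm]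
    refine measure_mono_null ?_ (ω.walkLaw_eval_zero 0)
    intro X hX hX0
    refine hX ?_
    have : X 0 = 0 := hX0
    change (1 / Real.sqrt n) • interpolate X (0 * n) = 0
    ext i
    simp [interpolate, this, Site.toReal]
  · obtain ⟨D, n₀, hD, h⟩ := Conductances.exists_modulus_bound hd (by linarith) (by linarith) hpq hK
      (T + 1) (ε := ε / 3) (by positivity) hη
    refine ⟨2 * D, max n₀ (2 * D), fun n hn => ?_⟩
    rw [Conductances.pathLaw, Measure.map_apply (measurable_rescaledPath n)
      (PathSpace.isOpen_oscillating _ _ _ _).measurableSet]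
    refine (measure_mono fun X hX => ?_).trans (h n ((le_max_left _ _).trans hn))
    exact exists_lt_dist1_of_oscillating hD ((le_max_right _ _).trans hn) hX
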